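/- For a metric space $X$ let $PX$ be the set of Radon probability measures $p$ on $X$ (with its Borel $\sigma$-algebra) of finite first moment, i.e. such that $\int f\,dp$ exists and is finite for every short ($1$-Lipschitz) map $f:X\to\mathbb{R}$. Equip $PX$ with the Kantorovich–Wasserstein distance $d(p,q)=\sup_f\left(\int f\,dq-\int f\,dp\right)$, where $f$ ranges over all short maps $X\to\mathbb{R}$. Let $X\otimes Y$ denote the cartesian product with the metric $d((x,y),(x',y'))=d(x,x')+d(y,y')$ and its Borel $\sigma$-algebra. Let $\Delta:P(X\otimes Y)\to PX\otimes PY$ be the map sending a measure to its pair of marginals, and for $p\in PX$, $q\in PY$ let $\Gamma(p,q)$ be the set of all Borel probability measures on $X\otimes Y$ with marginals $p$ and $q$. **Theorem.** Let $X$ and $Y$ be complete metric spaces (not necessarily separable). 1. The map $\Delta$ is short and has the metric lifting property: for every $C>0$, $r\in P(X\otimes Y)$ and $(p',q')\in PX\otimes PY$ with $d(\Delta(r),(p',q'))<C$ there is $r'\in P(X\otimes Y)$ with $\Delta(r')=(p',q')$ and $d(r,r')<C$. 2. The map $\Delta$ is proper: preimages of compact sets under $\Delta$ are compact. 3. For all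 $p\in PX$ and $q\in PY$ one has $\Gamma(p,q)=\Delta^{-1}(p,q)$ (in particular every coupling is Radon with finite first moment), and this set is compact in the topology of the Kantorovich–Wasserstein distance on $P(X\otimes Y)$. 4. Let $p,q\in PX$ and let $c:X\otimes X\to[0,\infty)$ be a lower semicontinuous function with $c(x,y)\le d(x,y)$ and $c(x,z)\le c(x,y)+c(y,z)$ for all $x,y,z\in X$. Then $c$ is integrable with respect to every $r\in\Gamma(p,q)$, the infimum of $\int c\,dr$ over $r\in\Gamma(p,q)$ is attained, and $$\min_{r\in\Gamma(p,q)}\int_{X\times X} c(x,y)\,dr(x,y)=\sup_f\left(\int_X f\,dq-\int_X f\,dp\right),$$ where $f$ ranges over all functions $X\to\mathbb{R}$ with $f(y)-f(x)\le c(x,y)$ for all $x,y\in X$. -/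

import Mathlib

open MeasureTheory

/-! ### The tensor product of metric spaces -/

/-- `X ⊗ Y`: the cartesian product with the `ℓ¹`-sum of the metrics. It carries its Borel
`σ`-algebra, which may be larger than the product `σ`-algebra if the spaces are not separable. -/
def MetTensor (X Y : Type*) : Type _ := WithLp 1 (X × Y)

namespace MetTensor

variable {X Y : Type*}

def mk (x : X) (y : Y) : MetTensor X Y := WithLp.toLp 1 (x, y)

def fst (z : MetTensor X Y) : X := (WithLp.ofLp z).1

def snd (z : MetTensor X Y) : Y := (WithLp.ofLp z).2

@[simp] theorem fst_mk (x : X) (y : Y) : (mk x y).fst = x := rfl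

@[simp] theorem snd_mk (x : X) (y : Y) : (mk x y).snd = y := rfl

@[simp] theorem mk_fst_snd (z : MetTensor X Y) : mk z.fst z.snd = z := rfl

variable [MetricSpace X] [MetricSpace Y]

noncomputable instance : MetricSpace (MetTensor X Y) :=
  inferInstanceAs (MetricSpace (WithLp 1 (X × Y)))

theorem dist_eq (z w : MetTensor X Y) : dist z w = dist z.fst w.fst + dist z.snd w.snd := by
  have h := WithLp.prod_dist_eq_add (p := 1) (α := X) (β := Y) (by simp) z w
  simp only [ENNReal.toReal_one, Real.rpow_one, div_one] at h
  exact h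

noncomputable instance : MeasurableSpace (MetTensor X Y) := borel _

instance : BorelSpace (MetTensor X Y) := ⟨rfl⟩

theorem lipschitzWith_fst : LipschitzWith 1 (fst : MetTensor X Y → X) :=
  LipschitzWith.of_dist_le_mul fun z w => by
    rw [dist_eq, NNReal.coe_one, one_mul]
    exact le_add_of_nonneg_right dist_nonneg

theorem lipschitzWith_snd : LipschitzWith 1 (snd : MetTensor X Y → Y) :=
  LipschitzWith.of_dist_le_mul fun z w => by
    rw [dist_eq, NNReal.coe_one, one_mul]
    exact le_add_of_nonneg_left dist_nonneg

end MetTensor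

/-! ### The Kantorovich-Wasserstein space -/

/-- `PX`: the Radon probability measures on `X` of finite first moment, that is, those against
which all short maps `X → ℝ` are integrable. -/
@[ext]
structure KSpace (X : Type*) [MetricSpace X] [MeasurableSpace X] where
  toMeasure : Measure X
  isProbabilityMeasure : IsProbabilityMeasure toMeasure
  innerRegular : toMeasure.InnerRegular
  integrable_of_short : ∀ f : X → ℝ, LipschitzWith 1 f → Integrable f toMeasure

namespace KSpace

section Metric

variable {X : Type*} [MetricSpace X] [MeasurableSpace X]

instance (p : KSpace X) : IsProbabilityMeasure p.toMeasure := p.isProbabilityMeasure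

/-- The Kantorovich-Wasserstein distance: the supremum of `∫ f dq - ∫ f dp` over all short maps
`f : X → ℝ`. -/
noncomputable instance : Dist (KSpace X) where
  dist p q := ⨆ f : {f : X → ℝ // LipschitzWith 1 f},
    (∫ x, f.1 x ∂q.toMeasure - ∫ x, f.1 x ∂p.toMeasure)

theorem dist_def (p q : KSpace X) : dist p q = ⨆ f : {f : X → ℝ // LipschitzWith 1 f},
    (∫ x, f.1 x ∂q.toMeasure - ∫ x, f.1 x ∂p.toMeasure) := rfl

instance : Nonempty {f : X → ℝ // LipschitzWith 1 f} :=
  ⟨⟨fun _ => 0, (LipschitzWith.const 0).weaken zero_le_one⟩⟩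

theorem bddAbove_range (p q : KSpace X) :
    BddAbove (Set.range fun f : {f : X → ℝ // LipschitzWith 1 f} =>
      (∫ x, f.1 x ∂q.toMeasure - ∫ x, f.1 x ∂p.toMeasure)) := by
  obtain ⟨x₀⟩ := nonempty_of_isProbabilityMeasure p.toMeasure
  have hd : LipschitzWith 1 fun x : X => dist x x₀ := LipschitzWith.dist_left x₀
  refine ⟨∫ x, dist x x₀ ∂q.toMeasure + ∫ x, dist x x₀ ∂p.toMeasure, ?_⟩
  rintro _ ⟨⟨f, hf⟩, rfl⟩
  have hle : ∀ x, |f x - f x₀| ≤ dist x x₀ := fun x => by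
    simpa [Real.dist_eq] using hf.dist_le_mul x x₀
  have h1 : ∫ x, f x ∂q.toMeasure ≤ ∫ x, dist x x₀ ∂q.toMeasure + f x₀ := by
    have : ∫ x, f x ∂q.toMeasure ≤ ∫ x, (dist x x₀ + f x₀) ∂q.toMeasure :=
      integral_mono (q.integrable_of_short f hf)
        ((q.integrable_of_short _ hd).add (integrable_const _))
        fun x => by have := (abs_le.1 (hle x)).2; simp only; linarith
    rwa [integral_add (q.integrable_of_short _ hd) (integrable_const _), integral_const,
      probReal_univ, one_smul] at this
  have h2 : f x₀ - ∫ x, dist x x₀ ∂p.toMeasure ≤ ∫ x, f x ∂p.toMeasure := by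
    have : ∫ x, (f x₀ - dist x x₀) ∂p.toMeasure ≤ ∫ x, f x ∂p.toMeasure :=
      integral_mono ((integrable_const _).sub (p.integrable_of_short _ hd))
        (p.integrable_of_short f hf)
        fun x => by have := (abs_le.1 (hle x)).1; simp only; linarith
    rwa [integral_sub (integrable_const _) (p.integrable_of_short _ hd), integral_const,
      probReal_univ, one_smul] at this
  simp only
  linarith

theorem sub_le_dist (p q : KSpace X) {f : X → ℝ} (hf : LipschitzWith 1 f) :
    ∫ x, f x ∂q.toMeasure - ∫ x, f x ∂p.toMeasure ≤ dist p q :=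
  le_ciSup (bddAbove_range p q) ⟨f, hf⟩

theorem dist_comm_le (p q : KSpace X) : dist p q ≤ dist q p := by
  refine ciSup_le fun f => ?_
  have h := sub_le_dist q p f.2.neg
  simp only [Pi.neg_apply, integral_neg] at h
  linarith

theorem integral_eq_of_dist_eq_zero {p q : KSpace X} (h : dist p q = 0) {f : X → ℝ}
    (hf : LipschitzWith 1 f) : ∫ x, f x ∂p.toMeasure = ∫ x, f x ∂q.toMeasure := by
  have h1 := sub_le_dist p q hf
  have h2 := (sub_le_dist q p hf).trans (dist_comm_le q p)
  rw [h] at h1 h2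
  linarith

variable [BorelSpace X]

theorem eq_of_dist_eq_zero' {p q : KSpace X} (h : dist p q = 0) : p = q := by
  have key : ∀ (f : X → ℝ) (K : NNReal), LipschitzWith K f →
      ∫ x, f x ∂p.toMeasure = ∫ x, f x ∂q.toMeasure := by
    intro f K hf
    have hK : (0 : ℝ) < K + 1 := by positivity
    have hg : LipschitzWith 1 fun x => ((K : ℝ) + 1)⁻¹ * f x := by
      refine LipschitzWith.of_dist_le_mul fun x y => ?_
      have h1 := hf.dist_le_mul x y
      rw [Real.dist_eq] at h1 ⊢
      rw [← mul_sub, abs_mul, abs_of_pos (inv_pos.2 hK), NNReal.coe_one, one_mul,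
        inv_mul_le_iff₀ hK]
      nlinarith [dist_nonneg (x := x) (y := y)]
    have h2 := integral_eq_of_dist_eq_zero h hg
    rw [integral_const_mul, integral_const_mul] at h2
    exact mul_left_cancel₀ (inv_pos.2 hK).ne' h2
  refine KSpace.ext (ext_of_generate_finite _ ?_ isPiSystem_isClosed (fun F hF => ?_) (by simp))
  · rw [BorelSpace.measurable_eq (α := X), borel_eq_generateFrom_isClosed]
  · have hpos : ∀ n : ℕ, (0 : ℝ) < 1 / ((n : ℝ) + 1) := fun n => Nat.one_div_pos_of_nat
    have hp := tendsto_integral_thickenedIndicator_of_isClosed p.toMeasure hF hpos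
      tendsto_one_div_add_atTop_nhds_zero_nat
    have hq := tendsto_integral_thickenedIndicator_of_isClosed q.toMeasure hF hpos
      tendsto_one_div_add_atTop_nhds_zero_nat
    have he : ∀ n : ℕ, ∫ x, (thickenedIndicator (hpos n) F x : ℝ) ∂p.toMeasure
        = ∫ x, (thickenedIndicator (hpos n) F x : ℝ) ∂q.toMeasure := fun n =>
      key _ _ (LipschitzWith.of_dist_le_mul fun x y =>
        (lipschitzWith_thickenedIndicator (hpos n) F).dist_le_mul x y)
    simp_rw [he] at hp
    have := tendsto_nhds_unique hp hq
    rwa [measureReal_eq_measureReal_iff] at this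

noncomputable instance : MetricSpace (KSpace X) where
  dist_self p := by simp [dist_def]
  dist_comm p q := le_antisymm (dist_comm_le p q) (dist_comm_le q p)
  dist_triangle p q r := by
    refine ciSup_le fun f => ?_
    have h1 := sub_le_dist p q f.2
    have h2 := sub_le_dist q r f.2
    linarith
  eq_of_dist_eq_zero := eq_of_dist_eq_zero'

end Metric

section Marginals

variable {X Y : Type*} [MetricSpace X] [MeasurableSpace X] [BorelSpace X]
  [MetricSpace Y] [MeasurableSpace Y] [BorelSpace Y]

/-- The pushforward of `p ∈ PX` along a short map. -/
noncomputable def map (g : X → Y) (hg : LipschitzWith 1 g) (p : KSpace X) : KSpace Y where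
  toMeasure := p.toMeasure.map g
  isProbabilityMeasure :=
    Measure.isProbabilityMeasure_map hg.continuous.measurable.aemeasurable
  innerRegular :=
    haveI := p.innerRegular
    Measure.InnerRegular.map_of_continuous hg.continuous
  integrable_of_short f hf := by
    rw [integrable_map_measure hf.continuous.measurable.aestronglyMeasurable
      hg.continuous.measurable.aemeasurable]
    refine p.integrable_of_short _ ?_
    simpa using hf.comp hg

/-- The marginal map `Δ : P(X ⊗ Y) → PX ⊗ PY`. -/
noncomputable def marginals (r : KSpace (MetTensor X Y)) : MetTensor (KSpace X) (KSpace Y) :=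
  MetTensor.mk (r.map MetTensor.fst MetTensor.lipschitzWith_fst)
    (r.map MetTensor.snd MetTensor.lipschitzWith_snd)

/-- `Γ(p, q)`: all Borel probability measures on `X ⊗ Y` with marginals `p` and `q`. -/
def couplings (p : KSpace X) (q : KSpace Y) : Set (Measure (MetTensor X Y)) :=
  {r | IsProbabilityMeasure r ∧
    r.map MetTensor.fst = p.toMeasure ∧ r.map MetTensor.snd = q.toMeasure}

end Marginals

end KSpace

/-- The metric lifting property of a short map. -/
def HasMetricLifting {X Y : Type*} [MetricSpace X] [MetricSpace Y] (f : X → Y) : Prop :=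
  LipschitzWith 1 f ∧
    ∀ C : ℝ, 0 < C → ∀ (x : X) (y' : Y), dist (f x) y' < C → ∃ x' : X, f x' = y' ∧ dist x x' < C

/-!
Everything rests on a description of couplings by linear functionals. A coupling `r` of `p` and `q`
gives a positive linear functional on the space `KSpace.lipDominated (MetTensor X Y)` of continuous
functions dominated by a Lipschitz function, whose restrictions to functions of one variable are
integration against `p` and `q`. Conversely every such functional comes from a coupling
(`KSpace.IsCouplingFunctional.exists_coupling`): on bounded functions it is represented by a
Riesz-Markov-Kakutani measure on the Stone-Čech compactification of `X ⊗ Y`, and as `p` and `q` are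
Radon, this measure is concentrated on a `σ`-compact subset of `X ⊗ Y`
(`KSpace.exists_measure_of_tight`).
Unbounded functions are reached by truncation, the error being controlled by `p` and `q` alone.
This needs no separability.

Couplings can thus be produced by the M. Riesz extension theorem. By
`KSpace.exists_coupling_of_cone`, there is a coupling `r` subject to a cone of constraints
`∫ ψ dr ≤ b` as soon as `∫ f dp + ∫ g dq ≤ b` whenever `f ⊕ g ≤ ψ`. Two cones are used.

* Metric lifting: `d(r, r') ≤ D` says that `∫ ψ dr' ≤ ∫ ψ dr + L D` for all `L`-Lipschitz `ψ`.
  If `f ⊕ g ≤ ψ`, then `f` and `g` can be enlarged to `L`-Lipschitz functions by `c`-transforms,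
  and the compatibility condition holds for `D = d(p, p') + d(q, q')`. So the lift exists even with
  `d(r, r') ≤ d(Δ(r), (p', q'))`.
* Duality: the constraint is `∫ c dr ≤ m` with `m` the supremum over `f`. If `f ⊕ g ≤ c`, then a
  `c`-transform replaces `(f, g)` by a pair `(-h, h)`, because of the triangle inequality and the
  vanishing of `c` on the diagonal. The cost `c` is `1`-Lipschitz on `X ⊗ X`, as it satisfies the
  triangle inequality and is bounded by the metric.

Compactness of `Γ(p, q)` is obtained from ultrafilters: integrals converge along an ultrafilter on
`Γ(p, q)` to a positive functional with the same marginals, that is, to a coupling. Convergence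
in the Kantorovich-Wasserstein distance follows because finite sets are close to almost all of the
mass, uniformly over `Γ(p, q)`. Properness of `Δ` then follows from compactness of its fibres and
metric lifting.
-/

namespace KSpace

open Filter Topology Set

/-! ### Continuous functions dominated by a Lipschitz function -/

section Controlled

variable {X : Type*} [MetricSpace X]

/-- The space of continuous real functions that are dominated in absolute value by a Lipschitz
function. -/
def lipDominated (X : Type*) [MetricSpace X] : Submodule ℝ (X → ℝ) where
  carrier := {f | Continuous f ∧
    ∃ (K : NNReal) (g : X → ℝ), LipschitzWith K g ∧ ∀ x, |f x| ≤ g x}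
  add_mem' := by
    rintro f f' ⟨hf, K, g, hg, hfg⟩ ⟨hf', K', g', hg', hfg'⟩
    exact ⟨hf.add hf', K + K', fun x => g x + g' x, hg.add hg',
      fun x => (abs_add_le _ _).trans (add_le_add (hfg x) (hfg' x))⟩
  zero_mem' := ⟨continuous_const, 0, fun _ => 0, LipschitzWith.const 0, by simp⟩
  smul_mem' := by
    rintro c f ⟨hf, K, g, hg, hfg⟩
    refine ⟨hf.const_smul c, ‖|c|‖₊ * K, fun x => |c| • g x,
      (lipschitzWith_smul (|c|)).comp hg, fun x => ?_⟩
    simp only [Pi.smul_apply, smul_eq_mul, abs_mul]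
    exact mul_le_mul_of_nonneg_left (hfg x) (abs_nonneg c)

theorem lipDominated_continuous (f : lipDominated X) : Continuous f.1 := f.2.1

theorem mem_lipDominated_of_lipschitzWith {K : NNReal} {f : X → ℝ} (hf : LipschitzWith K f) :
    f ∈ lipDominated X :=
  ⟨hf.continuous, K, fun x => |f x|,
    LipschitzWith.of_dist_le_mul fun x y =>
      (abs_abs_sub_abs_le (f x) (f y)).trans (hf.dist_le_mul x y), fun _ => le_rfl⟩

theorem mem_lipDominated_of_sub_le {L : ℝ} (hL : 0 ≤ L) {f : X → ℝ}
    (hf : ∀ x y, f x - f y ≤ L * dist x y) : f ∈ lipDominated X :=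
  mem_lipDominated_of_lipschitzWith (LipschitzWith.of_le_add_mul L.toNNReal fun x y => by
    rw [Real.coe_toNNReal L hL]
    linarith [hf x y])

theorem mem_lipDominated_of_bounded {f : X → ℝ} (hf : Continuous f) (M : ℝ)
    (hM : ∀ x, |f x| ≤ M) : f ∈ lipDominated X :=
  ⟨hf, 0, fun _ => M, LipschitzWith.const M, hM⟩

variable [MeasurableSpace X]

theorem integrable_of_lipschitzWith (p : KSpace X) {K : NNReal} {f : X → ℝ}
    (hf : LipschitzWith K f) : Integrable f p.toMeasure := by
  have hK : (0 : ℝ) < K + 1 := by positivity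
  have hg : LipschitzWith 1 fun x => ((K : ℝ) + 1)⁻¹ * f x := by
    refine LipschitzWith.of_dist_le_mul fun x y => ?_
    have h1 := hf.dist_le_mul x y
    rw [Real.dist_eq] at h1 ⊢
    rw [← mul_sub, abs_mul, abs_of_pos (inv_pos.2 hK), NNReal.coe_one, one_mul,
      inv_mul_le_iff₀ hK]
    nlinarith [dist_nonneg (x := x) (y := y)]
  have := (p.integrable_of_short _ hg).const_mul ((K : ℝ) + 1)
  simpa [← mul_assoc, mul_inv_cancel₀ hK.ne'] using this

theorem integral_sub_le_mul_dist (p q : KSpace X) {L : ℝ} (hL : 0 ≤ L) {f : X → ℝ}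
    (hf : ∀ x y, f x - f y ≤ L * dist x y) :
    ∫ x, f x ∂q.toMeasure - ∫ x, f x ∂p.toMeasure ≤ L * dist p q := by
  have habs : ∀ x y, |f x - f y| ≤ L * dist x y := fun x y =>
    abs_sub_le_iff.2 ⟨hf x y, by rw [dist_comm]; exact hf y x⟩
  rcases hL.eq_or_lt with rfl | hL
  · obtain ⟨x₀⟩ := nonempty_of_isProbabilityMeasure p.toMeasure
    have : f = fun _ => f x₀ := by
      funext x
      have := habs x x₀
      rw [zero_mul] at this
      exact sub_eq_zero.1 (abs_nonpos_iff.1 this)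
    rw [this]
    simp
  · have hg : LipschitzWith 1 fun x => L⁻¹ * f x := by
      refine LipschitzWith.of_dist_le_mul fun x y => ?_
      rw [Real.dist_eq, ← mul_sub, abs_mul, abs_of_pos (inv_pos.2 hL), NNReal.coe_one, one_mul,
        inv_mul_le_iff₀ hL]
      exact habs x y
    have h := sub_le_dist p q hg
    rwa [integral_const_mul, integral_const_mul, ← mul_sub, inv_mul_le_iff₀ hL] at h

variable [BorelSpace X]

theorem integrable_of_mem_lipDominated (p : KSpace X) {f : X → ℝ} (hf : f ∈ lipDominated X) :
    Integrable f p.toMeasure := by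
  obtain ⟨hc, K, g, hg, hfg⟩ := hf
  exact (p.integrable_of_lipschitzWith hg).mono' hc.measurable.aestronglyMeasurable
    (Eventually.of_forall hfg)

/-- Integration against `p ∈ PX`, as a linear functional. -/
noncomputable def integralLM (p : KSpace X) : lipDominated X →ₗ[ℝ] ℝ where
  toFun f := ∫ x, f.1 x ∂p.toMeasure
  map_add' f g := integral_add (p.integrable_of_mem_lipDominated f.2)
    (p.integrable_of_mem_lipDominated g.2)
  map_smul' c _ := integral_const_mul c _

theorem exists_isCompact_measure_compl_le (p : KSpace X) {ε : ENNReal} (hε : 0 < ε) :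
    ∃ K : Set X, IsCompact K ∧ p.toMeasure Kᶜ ≤ ε := by
  have := p.innerRegular
  simpa using isTightMeasureSet_iff_exists_isCompact_measure_compl_le.1
    (isTightMeasureSet_singleton_of_innerRegular (μ := p.toMeasure)) ε hε

/-- A measure in `PX` is concentrated on a separable set, so finite sets come arbitrarily close to
its points on average. -/
theorem exists_finset_integral_infDist_le (p : KSpace X) {ε : ℝ} (hε : 0 < ε) :
    ∃ N : Finset X, N.Nonempty ∧ ∫ x, Metric.infDist x N ∂p.toMeasure ≤ ε := by
  classical
  obtain ⟨x₀⟩ := nonempty_of_isProbabilityMeasure p.toMeasure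
  have hK : ∀ n : ℕ, ∃ K : Set X, IsCompact K ∧ p.toMeasure Kᶜ ≤ ((n : ENNReal) + 1)⁻¹ :=
    fun n => p.exists_isCompact_measure_compl_le (by simp)
  choose K hKc hKp using hK
  have hae : ∀ᵐ x ∂p.toMeasure, x ∈ ⋃ n, K n := by
    rw [ae_iff]
    refine le_antisymm (ge_of_tendsto' (x := atTop) (f := fun n : ℕ => ((n : ENNReal) + 1)⁻¹) ?_
      fun n => ?_) zero_le
    · exact_mod_cast ENNReal.tendsto_inv_nat_nhds_zero.comp (tendsto_add_atTop_nat 1)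
    · refine (measure_mono fun x hx => ?_).trans (hKp n)
      simp only [mem_iUnion, not_exists] at hx
      exact hx n
  obtain ⟨c, hc, hKc'⟩ : TopologicalSpace.IsSeparable (⋃ n, K n) :=
    TopologicalSpace.IsSeparable.iUnion fun n => (hKc n).isSeparable
  obtain ⟨u, hu⟩ := (hc.insert x₀).exists_eq_range (insert_nonempty x₀ c)
  let N : ℕ → Finset X := fun n => insert x₀ ((Finset.range n).image u)
  have hN : ∀ n, (N n : Set X).Nonempty := fun n => ⟨x₀, by simp [N]⟩
  have hlim : Tendsto (fun n => ∫ x, Metric.infDist x (N n) ∂p.toMeasure) atTop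
      (𝓝 (∫ _, (0 : ℝ) ∂p.toMeasure)) := by
    refine tendsto_integral_of_dominated_convergence (fun x => dist x x₀)
      (fun n => (Metric.continuous_infDist_pt _).measurable.aestronglyMeasurable)
      (p.integrable_of_short _ (LipschitzWith.dist_left x₀)) (fun n => ?_) ?_
    · refine Eventually.of_forall fun x => ?_
      rw [Real.norm_of_nonneg Metric.infDist_nonneg]
      exact Metric.infDist_le_dist_of_mem (by simp [N])
    · filter_upwards [hae] with x hx
      rw [Metric.tendsto_atTop]
      intro δ hδ
      have hx' : x ∈ closure (range u) := by
        rw [← hu]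
        exact closure_mono (subset_insert _ _) (hKc' hx)
      obtain ⟨_, ⟨k, rfl⟩, hk⟩ := Metric.mem_closure_iff.1 hx' δ hδ
      refine ⟨k + 1, fun n hn => ?_⟩
      rw [Real.dist_eq, sub_zero, abs_of_nonneg Metric.infDist_nonneg]
      refine (Metric.infDist_le_dist_of_mem ?_).trans_lt hk
      simp only [N, Finset.coe_insert, Finset.coe_image, Finset.coe_range]
      exact mem_insert_of_mem _ ⟨k, by simpa using hn, rfl⟩
  rw [integral_zero] at hlim
  obtain ⟨n, hn⟩ := (hlim.eventually (ge_mem_nhds hε)).exists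
  exact ⟨N n, by simpa using hN n, hn⟩

end Controlled

/-! ### Functions and compact sets in the tensor product -/

section Tensor

variable {X Y : Type*} [MetricSpace X] [MetricSpace Y]

theorem measurable_fst [MeasurableSpace X] [BorelSpace X] :
    Measurable (MetTensor.fst : MetTensor X Y → X) :=
  MetTensor.lipschitzWith_fst.continuous.measurable

theorem measurable_snd [MeasurableSpace Y] [BorelSpace Y] :
    Measurable (MetTensor.snd : MetTensor X Y → Y) :=
  MetTensor.lipschitzWith_snd.continuous.measurable

theorem integral_fst [MeasurableSpace X] [BorelSpace X] {r : Measure (MetTensor X Y)}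
    {μ : Measure X} (hr : r.map MetTensor.fst = μ) {f : X → ℝ} (hf : Continuous f) :
    ∫ z, f z.fst ∂r = ∫ x, f x ∂μ := by
  rw [← hr, integral_map measurable_fst.aemeasurable hf.measurable.aestronglyMeasurable]

theorem integral_snd [MeasurableSpace Y] [BorelSpace Y] {r : Measure (MetTensor X Y)}
    {μ : Measure Y} (hr : r.map MetTensor.snd = μ) {f : Y → ℝ} (hf : Continuous f) :
    ∫ z, f z.snd ∂r = ∫ y, f y ∂μ := by
  rw [← hr, integral_map measurable_snd.aemeasurable hf.measurable.aestronglyMeasurable]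

theorem continuous_mk : Continuous fun z : X × Y => MetTensor.mk z.1 z.2 :=
  WithLp.prod_continuous_toLp 1 X Y

/-- The product of two compact sets, in `X ⊗ Y`. -/
theorem isCompact_rect {K : Set X} {L : Set Y} (hK : IsCompact K) (hL : IsCompact L) :
    IsCompact {z : MetTensor X Y | z.fst ∈ K ∧ z.snd ∈ L} := by
  have : {z : MetTensor X Y | z.fst ∈ K ∧ z.snd ∈ L}
      = (fun z : X × Y => MetTensor.mk z.1 z.2) '' K ×ˢ L := by
    ext z
    constructor
    · intro hz
      exact ⟨(z.fst, z.snd), hz, rfl⟩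
    · rintro ⟨⟨x, y⟩, hz, rfl⟩
      exact hz
  rw [this]
  exact (hK.prod hL).image continuous_mk

theorem dist_mk_le (x₀ : X) (y₀ : Y) {K : NNReal} {φ : MetTensor X Y → ℝ}
    (hφ : LipschitzWith K φ) (z : MetTensor X Y) :
    |φ z - φ (MetTensor.mk x₀ y₀)| ≤ K * dist z.fst x₀ + K * dist z.snd y₀ := by
  have := hφ.dist_le_mul z (MetTensor.mk x₀ y₀)
  rw [Real.dist_eq, MetTensor.dist_eq] at this
  simpa [mul_add] using this

end Tensor

/-! ### Couplings are Radon measures of finite first moment -/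

section Couplings

variable {X Y : Type*} [MetricSpace X] [MeasurableSpace X] [BorelSpace X]
  [MetricSpace Y] [MeasurableSpace Y] [BorelSpace Y]

theorem couplings_innerRegular {p : KSpace X} {q : KSpace Y} {r : Measure (MetTensor X Y)}
    (hr : r ∈ couplings p q) : r.InnerRegular := by
  obtain ⟨hr1, hp, hq⟩ := hr
  have h1 : r.InnerRegularWRT IsCompact IsClosed := by
    refine innerRegularWRT_of_exists_compl_lt (fun A B hA hB => hA.inter_right hB) fun ε hε => ?_
    obtain ⟨δ, hδ, hδε⟩ := ENNReal.lt_iff_exists_nnreal_btwn.1 hε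
    have hδ2 : (0 : ENNReal) < δ / 2 := ENNReal.half_pos hδ.ne'
    obtain ⟨K, hK, hKp⟩ := p.exists_isCompact_measure_compl_le hδ2
    obtain ⟨L, hL, hLq⟩ := q.exists_isCompact_measure_compl_le hδ2
    refine ⟨_, isCompact_rect hK hL, lt_of_le_of_lt ?_ hδε⟩
    have hsub : {z : MetTensor X Y | z.fst ∈ K ∧ z.snd ∈ L}ᶜ
        ⊆ MetTensor.fst ⁻¹' Kᶜ ∪ MetTensor.snd ⁻¹' Lᶜ := by
      intro z hz
      by_contra h
      simp only [mem_union, mem_preimage, mem_compl_iff, not_or, not_not] at h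
      exact hz h
    calc r {z : MetTensor X Y | z.fst ∈ K ∧ z.snd ∈ L}ᶜ
        ≤ r (MetTensor.fst ⁻¹' Kᶜ) + r (MetTensor.snd ⁻¹' Lᶜ) :=
          (measure_mono hsub).trans (measure_union_le _ _)
      _ = p.toMeasure Kᶜ + q.toMeasure Lᶜ := by
          rw [← hp, ← hq, Measure.map_apply measurable_fst hK.measurableSet.compl,
            Measure.map_apply measurable_snd hL.measurableSet.compl]
      _ ≤ δ / 2 + δ / 2 := add_le_add hKp hLq
      _ = δ := ENNReal.add_halves _
  have h2 := h1.trans (Measure.WeaklyRegular.innerRegular_measurable (μ := r))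
  exact ⟨h2.mono (fun s hs => ⟨hs, measure_ne_top r s⟩) fun _ => id⟩

theorem couplings_integrable_of_short {p : KSpace X} {q : KSpace Y}
    {r : Measure (MetTensor X Y)} (hr : r ∈ couplings p q) (f : MetTensor X Y → ℝ)
    (hf : LipschitzWith 1 f) : Integrable f r := by
  obtain ⟨hr1, hp, hq⟩ := hr
  obtain ⟨x₀⟩ := nonempty_of_isProbabilityMeasure p.toMeasure
  obtain ⟨y₀⟩ := nonempty_of_isProbabilityMeasure q.toMeasure
  have h1 : Integrable (fun z : MetTensor X Y => dist z.fst x₀) r := by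
    have := p.integrable_of_short _ (LipschitzWith.dist_left x₀)
    rw [← hp] at this
    exact this.comp_measurable measurable_fst
  have h2 : Integrable (fun z : MetTensor X Y => dist z.snd y₀) r := by
    have := q.integrable_of_short _ (LipschitzWith.dist_left y₀)
    rw [← hq] at this
    exact this.comp_measurable measurable_snd
  refine ((integrable_const |f (MetTensor.mk x₀ y₀)|).add (h1.add h2)).mono'
    hf.continuous.measurable.aestronglyMeasurable (Eventually.of_forall fun z => ?_)
  have := dist_mk_le x₀ y₀ hf z
  simp only [NNReal.coe_one, one_mul] at this
  have h3 := abs_sub_abs_le_abs_sub (f z) (f (MetTensor.mk x₀ y₀))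
  simp only [Real.norm_eq_abs, Pi.add_apply]
  linarith

/-- A coupling of two measures in `PX` and `PY`, as a point of `P(X ⊗ Y)`. -/
def ofCoupling {p : KSpace X} {q : KSpace Y} {r : Measure (MetTensor X Y)}
    (hr : r ∈ couplings p q) : KSpace (MetTensor X Y) where
  toMeasure := r
  isProbabilityMeasure := hr.1
  innerRegular := couplings_innerRegular hr
  integrable_of_short := couplings_integrable_of_short hr

theorem marginals_eq_iff {p : KSpace X} {q : KSpace Y} {r : KSpace (MetTensor X Y)} :
    marginals r = MetTensor.mk p q ↔ r.toMeasure ∈ couplings p q := by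
  constructor
  · intro h
    exact ⟨r.isProbabilityMeasure, congrArg (fun w => (MetTensor.fst w).toMeasure) h,
      congrArg (fun w => (MetTensor.snd w).toMeasure) h⟩
  · intro h
    have h1 : r.map MetTensor.fst MetTensor.lipschitzWith_fst = p := KSpace.ext h.2.1
    have h2 : r.map MetTensor.snd MetTensor.lipschitzWith_snd = q := KSpace.ext h.2.2
    simp only [marginals, h1, h2]

end Couplings

/-! ### Representation of tight functionals by measures -/

section Representation

variable {Z : Type*} [MetricSpace Z]

theorem one_mem_lipDominated : (fun _ : Z => (1 : ℝ)) ∈ lipDominated Z :=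
  mem_lipDominated_of_lipschitzWith (LipschitzWith.const 1)

/-- Restriction along `Z → βZ`, from continuous functions on `βZ` to bounded continuous functions
on `Z`. -/
def ofStoneCech : CompactlySupportedContinuousMap (StoneCech Z) ℝ →ₗ[ℝ] lipDominated Z where
  toFun F := ⟨fun z => F (stoneCechUnit z), by
    obtain ⟨M, hM⟩ := (isCompact_univ (X := StoneCech Z)).exists_bound_of_continuousOn
      F.continuous.continuousOn
    exact mem_lipDominated_of_bounded (F.continuous.comp continuous_stoneCechUnit) M
      fun z => hM _ (mem_univ _)⟩
  map_add' _ _ := rfl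
  map_smul' _ _ := rfl

variable [MeasurableSpace Z] [BorelSpace Z]

/-- A positive normalised functional that is tight is given, on bounded continuous functions, by a
probability measure: the Riesz-Markov-Kakutani measure on the Stone-Čech compactification is
concentrated on a `σ`-compact subset of `Z`, hence can be pulled back to `Z`. -/
theorem exists_measure_of_tight (Λ : lipDominated Z →ₗ[ℝ] ℝ)
    (hpos : ∀ φ : lipDominated Z, (∀ z, 0 ≤ φ.1 z) → 0 ≤ Λ φ)
    (hone : Λ ⟨_, one_mem_lipDominated⟩ = 1)
    (htight : ∀ ε : ℝ, 0 < ε → ∃ C : Set Z, IsCompact C ∧ ∀ φ : lipDominated Z,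
      (∀ z, 0 ≤ φ.1 z) → (∀ z, φ.1 z ≤ 1) → (∀ z ∈ C, φ.1 z = 0) → Λ φ ≤ ε) :
    ∃ r : Measure Z, IsProbabilityMeasure r ∧
      ∀ (φ : lipDominated Z) (M : ℝ), (∀ z, |φ.1 z| ≤ M) → ∫ z, φ.1 z ∂r = Λ φ := by
  let _ : MeasurableSpace (StoneCech Z) := borel _
  have : BorelSpace (StoneCech Z) := ⟨rfl⟩
  let j : Z → StoneCech Z := stoneCechUnit
  have hj : Continuous j := continuous_stoneCechUnit
  have hji : Function.Injective j := injective_stoneCechUnit_of_t35Space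
  let Λ' : CompactlySupportedContinuousMap (StoneCech Z) ℝ →ₚ[ℝ] ℝ :=
    { toLinearMap := Λ ∘ₗ ofStoneCech
      monotone' := fun F G hFG => by
        have h := hpos (ofStoneCech (G - F)) fun z => sub_nonneg.2 (hFG _)
        rw [map_sub, map_sub] at h
        exact sub_nonneg.1 h }
  let ν := RealRMK.rieszMeasure Λ'
  have hν : IsFiniteMeasure ν := inferInstance
  choose C hC hCε using fun n : ℕ => htight (1 / ((n : ℝ) + 1)) Nat.one_div_pos_of_nat
  have hjC : ∀ n, IsCompact (j '' C n) := fun n => (hC n).image hj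
  have hνC : ∀ n, ν (j '' C n)ᶜ ≤ ENNReal.ofReal (1 / ((n : ℝ) + 1)) := by
    intro n
    rw [(hjC n).isClosed.isOpen_compl.measure_eq_iSup_isCompact]
    refine iSup₂_le fun D hD => iSup_le fun hDc => ?_
    obtain ⟨F, hF0, hF1, hF⟩ := exists_continuous_zero_one_of_isClosed (hjC n).isClosed
      hDc.isClosed (disjoint_left.2 fun x hx hxD => hD hxD hx)
    let G : CompactlySupportedContinuousMap (StoneCech Z) ℝ :=
      ⟨F, HasCompactSupport.of_compactSpace _⟩
    refine (RealRMK.rieszMeasure_le_of_eq_one Λ' (f := G) (fun x => (hF x).1) hDc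
      fun x hx => hF1 hx).trans (ENNReal.ofReal_le_ofReal ?_)
    exact hCε n (ofStoneCech G) (fun z => (hF _).1) (fun z => (hF _).2)
      fun z hz => hF0 (mem_image_of_mem j hz)
  have hνS : ν (⋃ n, j '' C n)ᶜ = 0 := by
    refine le_antisymm (ge_of_tendsto' (x := atTop)
      (f := fun n : ℕ => ENNReal.ofReal (1 / ((n : ℝ) + 1))) ?_ fun n => ?_) zero_le
    · simpa using ENNReal.tendsto_ofReal (tendsto_one_div_add_atTop_nhds_zero_nat (𝕜 := ℝ))
    · exact (measure_mono (compl_subset_compl.2 (subset_iUnion (fun n => j '' C n) n))).trans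
        (hνC n)
  have hmeas : ∀ (n : ℕ) (B : Set Z), MeasurableSet B → MeasurableSet (j '' (B ∩ C n)) := by
    intro n B hB
    have : CompactSpace (C n) := isCompact_iff_compactSpace.1 (hC n)
    have he : IsClosedEmbedding fun z : C n => j z :=
      (hj.comp continuous_subtype_val).isClosedEmbedding (hji.comp Subtype.val_injective)
    have : j '' (B ∩ C n) = (fun z : C n => j z) '' (Subtype.val ⁻¹' B) := by
      ext x
      constructor
      · rintro ⟨z, ⟨hzB, hzC⟩, rfl⟩
        exact ⟨⟨z, hzC⟩, hzB, rfl⟩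
      · rintro ⟨z, hz, rfl⟩
        exact ⟨z, ⟨hz, z.2⟩, rfl⟩
    rw [this]
    exact he.measurableEmbedding.measurableSet_image.2 (measurable_subtype_coe hB)
  have hnull : ∀ B : Set Z, MeasurableSet B → NullMeasurableSet (j '' B) ν := by
    intro B hB
    have hsplit : j '' B = (⋃ n, j '' (B ∩ C n)) ∪ j '' (B \ ⋃ n, C n) := by
      rw [← image_iUnion, ← image_union, ← inter_iUnion, inter_union_sdiff]
    rw [hsplit]
    refine (MeasurableSet.iUnion fun n => hmeas n B hB).nullMeasurableSet.union
      (NullMeasurableSet.of_null (measure_mono_null ?_ hνS))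
    rintro _ ⟨z, hz, rfl⟩ hzC
    rw [← image_iUnion] at hzC
    exact hz.2 ((hji.mem_set_image).1 hzC)
  -- `hji` and `hnull` ensure that `comap` does not have its junk value `0`
  let r : Measure Z := ν.comap j
  have hr : ∀ B, MeasurableSet B → r B = ν (j '' B) := fun B hB =>
    Measure.comap_apply₀ j ν hji hnull hB.nullMeasurableSet
  have hrfin : IsFiniteMeasure r := ⟨by
    rw [hr univ MeasurableSet.univ]
    exact measure_lt_top ν _⟩
  have hmap : r.map j = ν := by
    ext B hB
    rw [Measure.map_apply hj.measurable hB, hr _ (hj.measurable hB), image_preimage_eq_inter_range]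
    refine le_antisymm (measure_mono inter_subset_left) ?_
    calc ν B ≤ ν (B ∩ range j ∪ (⋃ n, j '' C n)ᶜ) := by
          refine measure_mono fun x hx => ?_
          by_cases h : x ∈ range j
          · exact Or.inl ⟨hx, h⟩
          · refine Or.inr fun hx' => h ?_
            rw [← image_iUnion] at hx'
            exact image_subset_range _ _ hx'
      _ ≤ ν (B ∩ range j) + ν (⋃ n, j '' C n)ᶜ := measure_union_le _ _
      _ = ν (B ∩ range j) := by rw [hνS, add_zero]
  have hint : ∀ (φ : lipDominated Z) (M : ℝ), (∀ z, |φ.1 z| ≤ M) → ∫ z, φ.1 z ∂r = Λ φ := by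
    intro φ M hM
    have hgc : Continuous fun z => (⟨φ.1 z, abs_le.1 (hM z)⟩ : Icc (-M) M) :=
      (lipDominated_continuous φ).subtype_mk _
    let F : CompactlySupportedContinuousMap (StoneCech Z) ℝ :=
      ⟨⟨fun x => (stoneCechExtend hgc x : Icc (-M) M).1,
        continuous_subtype_val.comp (continuous_stoneCechExtend hgc)⟩,
        HasCompactSupport.of_compactSpace _⟩
    have hF : ∀ z, F (j z) = φ.1 z := fun z =>
      congrArg Subtype.val (stoneCechExtend_stoneCechUnit hgc z)
    have hFφ : ofStoneCech F = φ := Subtype.ext (funext hF)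
    calc ∫ z, φ.1 z ∂r = ∫ z, F (j z) ∂r := by simp_rw [hF]
      _ = ∫ x, F x ∂ν := by
          rw [← hmap]
          exact (integral_map hj.measurable.aemeasurable
            F.continuous.measurable.aestronglyMeasurable).symm
      _ = Λ (ofStoneCech F) := RealRMK.integral_rieszMeasure Λ' F
      _ = Λ φ := by rw [hFφ]
  refine ⟨r, ⟨?_⟩, hint⟩
  have h1 := hint ⟨_, one_mem_lipDominated⟩ 1 (by simp)
  rw [hone] at h1
  simp only [integral_const, smul_eq_mul, mul_one] at h1
  rwa [measureReal_def, ENNReal.toReal_eq_one_iff] at h1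

end Representation

/-! ### Positive functionals with given marginals -/

section CouplingFunctional

variable {X Y Z : Type*} [MetricSpace X] [MetricSpace Y] [MetricSpace Z]

/-- Precomposition with a short map. -/
def pullback (g : Z → X) (hg : LipschitzWith 1 g) : lipDominated X →ₗ[ℝ] lipDominated Z where
  toFun f := ⟨fun z => f.1 (g z), by
    obtain ⟨hc, K, h, hh, hfh⟩ := f.2
    exact ⟨hc.comp hg.continuous, K * 1, fun z => h (g z), hh.comp hg, fun z => hfh (g z)⟩⟩
  map_add' _ _ := rfl
  map_smul' _ _ := rfl

theorem exists_lipschitz_add_bound [Nonempty X] [Nonempty Y]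
    (φ : lipDominated (MetTensor X Y)) :
    ∃ (K : NNReal) (a : X → ℝ) (b : Y → ℝ), LipschitzWith K a ∧ LipschitzWith K b ∧
      ∀ z : MetTensor X Y, |φ.1 z| ≤ a z.fst + b z.snd := by
  obtain ⟨x₀⟩ := ‹Nonempty X›
  obtain ⟨y₀⟩ := ‹Nonempty Y›
  obtain ⟨-, K, ψ, hψ, hφψ⟩ := φ.2
  refine ⟨K, fun x => |ψ (MetTensor.mk x₀ y₀)| + K * dist x x₀, fun y => K * dist y y₀,
    LipschitzWith.of_le_add_mul K fun x y => ?_, LipschitzWith.of_le_add_mul K fun x y => ?_,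
    fun z => ?_⟩
  · nlinarith [dist_triangle x y x₀, K.2]
  · nlinarith [dist_triangle x y y₀, K.2]
  · have h1 := (abs_le.1 (dist_mk_le x₀ y₀ hψ z)).2
    have h2 := le_abs_self (ψ (MetTensor.mk x₀ y₀))
    have h3 := hφψ z
    simp only
    linarith

variable [MeasurableSpace X] [MeasurableSpace Y]

/-- A positive linear functional with marginals `p` and `q`: the functional-analytic counterpart
of a coupling. -/
structure IsCouplingFunctional (p : KSpace X) (q : KSpace Y)
    (Λ : lipDominated (MetTensor X Y) →ₗ[ℝ] ℝ) : Prop where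
  nonneg : ∀ φ : lipDominated (MetTensor X Y), (∀ z, 0 ≤ φ.1 z) → 0 ≤ Λ φ
  fst : ∀ f : lipDominated X, Λ (pullback MetTensor.fst MetTensor.lipschitzWith_fst f)
    = ∫ x, f.1 x ∂p.toMeasure
  snd : ∀ g : lipDominated Y, Λ (pullback MetTensor.snd MetTensor.lipschitzWith_snd g)
    = ∫ y, g.1 y ∂q.toMeasure

variable {p : KSpace X} {q : KSpace Y} {Λ : lipDominated (MetTensor X Y) →ₗ[ℝ] ℝ}

theorem IsCouplingFunctional.le_of_le_add (hΛ : IsCouplingFunctional p q Λ)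
    {φ : lipDominated (MetTensor X Y)} (f : lipDominated X) (g : lipDominated Y)
    (h : ∀ z : MetTensor X Y, φ.1 z ≤ f.1 z.fst + g.1 z.snd) :
    Λ φ ≤ ∫ x, f.1 x ∂p.toMeasure + ∫ y, g.1 y ∂q.toMeasure := by
  rw [← hΛ.fst, ← hΛ.snd, ← map_add, ← sub_nonneg, ← map_sub]
  exact hΛ.nonneg _ fun z => sub_nonneg.2 (h z)

theorem IsCouplingFunctional.add_le_of_add_le (hΛ : IsCouplingFunctional p q Λ)
    {φ : lipDominated (MetTensor X Y)} (f : lipDominated X) (g : lipDominated Y)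
    (h : ∀ z : MetTensor X Y, f.1 z.fst + g.1 z.snd ≤ φ.1 z) :
    ∫ x, f.1 x ∂p.toMeasure + ∫ y, g.1 y ∂q.toMeasure ≤ Λ φ := by
  rw [← hΛ.fst, ← hΛ.snd, ← map_add, ← sub_nonneg, ← map_sub]
  exact hΛ.nonneg _ fun z => sub_nonneg.2 (h z)

theorem IsCouplingFunctional.abs_le_of_abs_le_add (hΛ : IsCouplingFunctional p q Λ)
    {φ : lipDominated (MetTensor X Y)} (f : lipDominated X) (g : lipDominated Y)
    (h : ∀ z : MetTensor X Y, |φ.1 z| ≤ f.1 z.fst + g.1 z.snd) :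
    |Λ φ| ≤ ∫ x, f.1 x ∂p.toMeasure + ∫ y, g.1 y ∂q.toMeasure := by
  refine abs_le'.2 ⟨hΛ.le_of_le_add f g fun z => (le_abs_self _).trans (h z), ?_⟩
  rw [← map_neg]
  exact hΛ.le_of_le_add f g fun z => (neg_le_abs _).trans (h z)

theorem IsCouplingFunctional.map_one (hΛ : IsCouplingFunctional p q Λ) :
    Λ ⟨_, one_mem_lipDominated⟩ = 1 :=
  (hΛ.fst ⟨_, one_mem_lipDominated⟩).trans (by simp)

variable [BorelSpace X] [BorelSpace Y]

theorem isCouplingFunctional_integralLM {p : KSpace X} {q : KSpace Y}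
    {r : KSpace (MetTensor X Y)} (hr : r.toMeasure ∈ couplings p q) :
    IsCouplingFunctional p q r.integralLM where
  nonneg _ hφ := integral_nonneg hφ
  fst f := integral_fst hr.2.1 (lipDominated_continuous f)
  snd g := integral_snd hr.2.2 (lipDominated_continuous g)

/-- The cut-off `h = min 1 (d(x, K) / η)` vanishes on the compact set `K` and equals `1` away from
it, so that its integral does not exceed the mass outside `K`. -/
theorem exists_cutoff (p : KSpace X) {ε : ℝ} (hε : 0 < ε) : ∃ K : Set X, IsCompact K ∧
    ∀ η : ℝ, 0 < η → ∃ h : lipDominated X, (∀ x, 0 ≤ h.1 x) ∧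
      (∀ x, h.1 x < 1 → ∃ k ∈ K, dist x k < η) ∧ ∫ x, h.1 x ∂p.toMeasure ≤ ε := by
  obtain ⟨x₀⟩ := nonempty_of_isProbabilityMeasure p.toMeasure
  obtain ⟨K₀, hK₀, hpK₀⟩ := p.exists_isCompact_measure_compl_le (ENNReal.ofReal_pos.2 hε)
  have hK : IsCompact (insert x₀ K₀) := hK₀.insert x₀
  have hne : (insert x₀ K₀).Nonempty := insert_nonempty _ _
  refine ⟨insert x₀ K₀, hK, fun η hη => ?_⟩
  have hc : Continuous fun x => min 1 (η⁻¹ * Metric.infDist x (insert x₀ K₀)) :=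
    continuous_const.min (continuous_const.mul (Metric.continuous_infDist_pt _))
  have h0 : ∀ x, 0 ≤ min 1 (η⁻¹ * Metric.infDist x (insert x₀ K₀)) := fun x =>
    le_min zero_le_one (mul_nonneg (inv_nonneg.2 hη.le) Metric.infDist_nonneg)
  have hmem := mem_lipDominated_of_bounded hc 1 fun x => by
    rw [abs_of_nonneg (h0 x)]
    exact min_le_left _ _
  refine ⟨⟨_, hmem⟩, h0, fun x hx => ?_, ?_⟩
  · have : η⁻¹ * Metric.infDist x (insert x₀ K₀) < 1 := by
      by_contra h
      simp only [min_eq_left (not_lt.1 h), lt_self_iff_false] at hx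
    rw [inv_mul_lt_iff₀ hη, mul_one] at this
    exact (Metric.infDist_lt_iff hne).1 this
  · calc ∫ x, min 1 (η⁻¹ * Metric.infDist x (insert x₀ K₀)) ∂p.toMeasure
        ≤ ∫ x, (insert x₀ K₀)ᶜ.indicator (fun _ => (1 : ℝ)) x ∂p.toMeasure := by
          refine integral_mono (p.integrable_of_mem_lipDominated hmem)
            ((integrable_const 1).indicator hK.measurableSet.compl) fun x => ?_
          by_cases hx : x ∈ insert x₀ K₀
          · simp only [Metric.infDist_zero_of_mem hx, mul_zero, indicator_of_notMem
              (notMem_compl_iff.2 hx), min_eq_right zero_le_one, le_refl]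
          · rw [indicator_of_mem (mem_compl hx)]
            exact min_le_left _ _
      _ = p.toMeasure.real (insert x₀ K₀)ᶜ := by
          rw [integral_indicator hK.measurableSet.compl]
          simp
      _ ≤ ε := by
          refine ENNReal.toReal_le_of_le_ofReal hε.le ((measure_mono ?_).trans hpK₀)
          exact compl_subset_compl.2 (subset_insert _ _)

/-- Positive functionals with Radon marginals are tight. -/
theorem IsCouplingFunctional.tight (hΛ : IsCouplingFunctional p q Λ) {ε : ℝ} (hε : 0 < ε) :
    ∃ C : Set (MetTensor X Y), IsCompact C ∧ ∀ φ : lipDominated (MetTensor X Y),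
      (∀ z, 0 ≤ φ.1 z) → (∀ z, φ.1 z ≤ 1) → (∀ z ∈ C, φ.1 z = 0) → Λ φ ≤ ε := by
  have hε3 : 0 < ε / 3 := by positivity
  obtain ⟨K, hK, hpK⟩ := p.exists_cutoff hε3
  obtain ⟨L, hL, hqL⟩ := q.exists_cutoff hε3
  refine ⟨_, isCompact_rect hK hL, fun φ _ hφ1 hφC => ?_⟩
  obtain ⟨η, hη, hηU⟩ := (isCompact_rect hK hL).exists_thickening_subset_open
    ((isOpen_Iio (a := ε / 3)).preimage (lipDominated_continuous φ)) fun z hz => by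
      rw [mem_preimage, hφC z hz]
      exact hε3
  obtain ⟨f, hf0, hfK, hfp⟩ := hpK (η / 2) (by positivity)
  obtain ⟨g, hg0, hgL, hgq⟩ := hqL (η / 2) (by positivity)
  have hconst : (fun _ : X => ε / 3) ∈ lipDominated X :=
    mem_lipDominated_of_lipschitzWith (LipschitzWith.const _)
  have key := hΛ.le_of_le_add (φ := φ) (⟨_, hconst⟩ + f) g fun z => by
    change φ.1 z ≤ ε / 3 + f.1 z.fst + g.1 z.snd
    rcases lt_or_ge (f.1 z.fst) 1 with hfz | hfz
    · rcases lt_or_ge (g.1 z.snd) 1 with hgz | hgz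
      · obtain ⟨k, hk, hzk⟩ := hfK _ hfz
        obtain ⟨l, hl, hzl⟩ := hgL _ hgz
        have hz : φ.1 z < ε / 3 := hηU (Metric.mem_thickening_iff.2
          ⟨MetTensor.mk k l, ⟨hk, hl⟩, by
            rw [MetTensor.dist_eq, MetTensor.fst_mk, MetTensor.snd_mk]
            linarith⟩)
        linarith [hf0 z.fst, hg0 z.snd]
      · linarith [hf0 z.fst, hφ1 z]
    · linarith [hg0 z.snd, hφ1 z]
  have hsum : ∫ x, (⟨_, hconst⟩ + f : lipDominated X).1 x ∂p.toMeasure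
      = ε / 3 + ∫ x, f.1 x ∂p.toMeasure := by
    have := p.integralLM.map_add ⟨_, hconst⟩ f
    refine this.trans ?_
    simp [integralLM]
  rw [hsum] at key
  linarith

theorem tendsto_integral_max_sub_nat (p : KSpace X) {K : NNReal} {a : X → ℝ}
    (ha : LipschitzWith K a) :
    Tendsto (fun n : ℕ => ∫ x, max (a x - n) 0 ∂p.toMeasure) atTop (𝓝 0) := by
  have h := tendsto_integral_of_dominated_convergence (μ := p.toMeasure)
    (F := fun (n : ℕ) x => max (a x - n) 0) (f := fun _ => 0) (fun x => |a x|)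
    (fun n => ((ha.continuous.sub continuous_const).max
      continuous_const).measurable.aestronglyMeasurable)
    (p.integrable_of_lipschitzWith ha).abs
    (fun n => Eventually.of_forall fun x => by
      rw [Real.norm_of_nonneg (le_max_right _ _)]
      refine max_le ?_ (abs_nonneg _)
      linarith [le_abs_self (a x), Nat.cast_nonneg (α := ℝ) n])
    (Eventually.of_forall fun x => by
      obtain ⟨N, hN⟩ := exists_nat_ge (a x)
      refine tendsto_const_nhds.congr' ?_
      filter_upwards [eventually_ge_atTop N] with n hn
      have : (N : ℝ) ≤ n := Nat.cast_le.2 hn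
      exact (max_eq_right (by linarith)).symm)
  simpa using h

/-- The values of a positive functional with marginals `p` and `q` are limits of its values on
truncations, at a rate that only depends on `p` and `q`. -/
theorem exists_truncation (p : KSpace X) (q : KSpace Y) (φ : lipDominated (MetTensor X Y)) :
    ∃ (φ' : ℕ → lipDominated (MetTensor X Y)) (e : ℕ → ℝ),
      (∀ n, ∃ M, ∀ z, |(φ' n).1 z| ≤ M) ∧ Tendsto e atTop (𝓝 0) ∧
      ∀ Λ, IsCouplingFunctional p q Λ → ∀ n, |Λ φ - Λ (φ' n)| ≤ e n := by
  have := nonempty_of_isProbabilityMeasure p.toMeasure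
  have := nonempty_of_isProbabilityMeasure q.toMeasure
  have hφc := lipDominated_continuous φ
  obtain ⟨K, a, b, ha, hb, hab⟩ := exists_lipschitz_add_bound φ
  have han : ∀ n : ℕ, (fun x => max (a x - n) 0) ∈ lipDominated X := fun n =>
    mem_lipDominated_of_lipschitzWith ((ha.sub (LipschitzWith.const (n : ℝ))).max_const 0)
  have hbn : ∀ n : ℕ, (fun x => max (b x - n) 0) ∈ lipDominated Y := fun n =>
    mem_lipDominated_of_lipschitzWith ((hb.sub (LipschitzWith.const (n : ℝ))).max_const 0)
  have htb : ∀ (n : ℕ) (z : MetTensor X Y), |max (-(2 * n : ℝ)) (min (φ.1 z) (2 * n))| ≤ 2 * n :=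
    fun n z => by
      have : (0 : ℝ) ≤ 2 * n := by positivity
      exact abs_le.2 ⟨le_max_left _ _, max_le (by linarith) (min_le_right _ _)⟩
  have htm : ∀ n : ℕ, (fun z => max (-(2 * n : ℝ)) (min (φ.1 z) (2 * n)))
      ∈ lipDominated (MetTensor X Y) := fun n =>
    mem_lipDominated_of_bounded (continuous_const.max (hφc.min continuous_const)) _ (htb n)
  refine ⟨fun n => ⟨_, htm n⟩, _, fun n => ⟨_, htb n⟩, by
    simpa using (p.tendsto_integral_max_sub_nat ha).add (q.tendsto_integral_max_sub_nat hb),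
    fun Λ hΛ n => ?_⟩
  rw [← map_sub]
  refine hΛ.abs_le_of_abs_le_add ⟨_, han n⟩ ⟨_, hbn n⟩ fun z => ?_
  change |φ.1 z - max (-(2 * n : ℝ)) (min (φ.1 z) (2 * n))|
    ≤ max (a z.fst - n) 0 + max (b z.snd - n) 0
  have h1 := abs_le.1 (hab z)
  have h2 := le_max_left (a z.fst - n) 0
  have h3 := le_max_right (a z.fst - n) 0
  have h4 := le_max_left (b z.snd - n) 0
  have h5 := le_max_right (b z.snd - n) 0
  have h6 : (0 : ℝ) ≤ n := Nat.cast_nonneg n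
  rcases le_total (φ.1 z) (2 * n) with h7 | h7
  · rw [min_eq_left h7]
    rcases le_total (-(2 * n : ℝ)) (φ.1 z) with h8 | h8
    · rw [max_eq_right h8, sub_self, abs_zero]
      linarith
    · rw [max_eq_left h8, abs_le]
      constructor <;> linarith
  · rw [min_eq_right h7, max_eq_right (by linarith), abs_le]
    constructor <;> linarith

/-- Positive functionals with marginals `p` and `q` are couplings of `p` and `q`. -/
theorem IsCouplingFunctional.exists_coupling (hΛ : IsCouplingFunctional p q Λ) :
    ∃ r : KSpace (MetTensor X Y), r.toMeasure ∈ couplings p q ∧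
      ∀ φ : lipDominated (MetTensor X Y), ∫ z, φ.1 z ∂r.toMeasure = Λ φ := by
  obtain ⟨r, hr1, hr⟩ := exists_measure_of_tight Λ hΛ.nonneg hΛ.map_one fun ε hε => hΛ.tight hε
  have hfst : r.map MetTensor.fst = p.toMeasure := by
    have := Measure.isProbabilityMeasure_map (μ := r)
      (measurable_fst (X := X) (Y := Y)).aemeasurable
    refine ext_of_forall_integral_eq_of_IsFiniteMeasure fun f => ?_
    have hf := mem_lipDominated_of_bounded f.continuous _ fun x => f.norm_coe_le_norm x
    rw [← integral_fst rfl f.continuous, ← hΛ.fst ⟨_, hf⟩]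
    exact hr (pullback _ MetTensor.lipschitzWith_fst ⟨_, hf⟩) ‖f‖
      fun z => f.norm_coe_le_norm z.fst
  have hsnd : r.map MetTensor.snd = q.toMeasure := by
    have := Measure.isProbabilityMeasure_map (μ := r)
      (measurable_snd (X := X) (Y := Y)).aemeasurable
    refine ext_of_forall_integral_eq_of_IsFiniteMeasure fun f => ?_
    have hf := mem_lipDominated_of_bounded f.continuous _ fun x => f.norm_coe_le_norm x
    rw [← integral_snd rfl f.continuous, ← hΛ.snd ⟨_, hf⟩]
    exact hr (pullback _ MetTensor.lipschitzWith_snd ⟨_, hf⟩) ‖f‖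
      fun z => f.norm_coe_le_norm z.snd
  have hrc : r ∈ couplings p q := ⟨hr1, hfst, hsnd⟩
  refine ⟨ofCoupling hrc, hrc, fun φ => ?_⟩
  obtain ⟨φ', e, hb, he, hφ'⟩ := exists_truncation p q φ
  have hle : ∀ n, |(ofCoupling hrc).integralLM φ - Λ φ| ≤ e n + e n := fun n => by
    have h1 := hφ' _ (isCouplingFunctional_integralLM (r := ofCoupling hrc) hrc) n
    have h2 := hφ' Λ hΛ n
    obtain ⟨M, hM⟩ := hb n
    have h3 : (ofCoupling hrc).integralLM (φ' n) = Λ (φ' n) := hr (φ' n) M hM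
    rw [h3] at h1
    rw [abs_sub_comm] at h2
    exact (abs_sub_le _ _ _).trans (add_le_add h1 h2)
  have h0 : |(ofCoupling hrc).integralLM φ - Λ φ| ≤ 0 :=
    ge_of_tendsto' (by simpa using he.add he) hle
  exact sub_eq_zero.1 (abs_nonpos_iff.1 h0)

end CouplingFunctional

/-! ### Couplings from the M. Riesz extension theorem -/

section Extension

variable {X Y : Type*} [MetricSpace X] [MetricSpace Y]

/-- Given a cone `A` of pairs `(ψ, b)`, read as constraints `Λ ψ ≤ b`, the cone of all
`(f, g, φ, t)` for which the constraints force `∫ f dp + ∫ g dq + Λ φ + t` to be nonnegative,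
whenever `Λ` is a positive functional with marginals `p` and `q`. -/
def constraintCone (A : PointedCone ℝ (lipDominated (MetTensor X Y) × ℝ)) :
    PointedCone ℝ (lipDominated X × lipDominated Y × lipDominated (MetTensor X Y) × ℝ) where
  carrier := {w | ∃ ψ b, (ψ, b) ∈ A ∧
    (∀ z, 0 ≤ w.1.1 z.fst + w.2.1.1 z.snd + w.2.2.1.1 z + ψ.1 z) ∧ b ≤ w.2.2.2}
  add_mem' := by
    rintro w w' ⟨ψ, b, hA, h, hb⟩ ⟨ψ', b', hA', h', hb'⟩
    refine ⟨ψ + ψ', b + b', A.add_mem hA hA', fun z => ?_, add_le_add hb hb'⟩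
    change 0 ≤ (w.1.1 z.fst + w'.1.1 z.fst) + (w.2.1.1 z.snd + w'.2.1.1 z.snd)
      + (w.2.2.1.1 z + w'.2.2.1.1 z) + (ψ.1 z + ψ'.1 z)
    linarith [h z, h' z]
  zero_mem' := ⟨0, 0, A.zero_mem, fun z => by simp, le_rfl⟩
  smul_mem' := by
    rintro c w ⟨ψ, b, hA, h, hb⟩
    refine ⟨c.1 • ψ, c.1 • b, A.smul_mem c.2 hA, fun z => ?_, smul_le_smul_of_nonneg_left hb c.2⟩
    change 0 ≤ c.1 * w.1.1 z.fst + c.1 * w.2.1.1 z.snd + c.1 * w.2.2.1.1 z + c.1 * ψ.1 z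
    have := mul_nonneg c.2 (h z)
    linarith

variable [MeasurableSpace X] [BorelSpace X] [MeasurableSpace Y] [BorelSpace Y]

/-- **Existence of couplings under constraints**: a cone of constraints `∫ ψ dr ≤ b` can be
satisfied by a coupling as soon as it is compatible with the prescribed marginals. -/
theorem exists_coupling_of_cone (p : KSpace X) (q : KSpace Y)
    (A : PointedCone ℝ (lipDominated (MetTensor X Y) × ℝ))
    (hA : ∀ ψ b, (ψ, b) ∈ A → ∀ (f : lipDominated X) (g : lipDominated Y),
      (∀ z : MetTensor X Y, f.1 z.fst + g.1 z.snd ≤ ψ.1 z) →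
      ∫ x, f.1 x ∂p.toMeasure + ∫ y, g.1 y ∂q.toMeasure ≤ b) :
    ∃ r : KSpace (MetTensor X Y), r.toMeasure ∈ couplings p q ∧
      ∀ ψ b, (ψ, b) ∈ A → ∫ z, ψ.1 z ∂r.toMeasure ≤ b := by
  have := nonempty_of_isProbabilityMeasure p.toMeasure
  have := nonempty_of_isProbabilityMeasure q.toMeasure
  let W := lipDominated X × lipDominated Y × lipDominated (MetTensor X Y) × ℝ
  let π : W →ₗ[ℝ] lipDominated (MetTensor X Y) :=
    LinearMap.fst ℝ _ _ ∘ₗ LinearMap.snd ℝ _ _ ∘ₗ LinearMap.snd ℝ _ _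
  let F : W →ₗ[ℝ] ℝ := p.integralLM ∘ₗ LinearMap.fst ℝ _ _
    + q.integralLM ∘ₗ LinearMap.fst ℝ _ _ ∘ₗ LinearMap.snd ℝ _ _
    + LinearMap.snd ℝ _ _ ∘ₗ LinearMap.snd ℝ _ _ ∘ₗ LinearMap.snd ℝ _ _
  obtain ⟨G, hGF, hG⟩ := riesz_extension (constraintCone A)
    ⟨LinearMap.ker π, F.domRestrict (LinearMap.ker π)⟩ (by
      rintro ⟨⟨f, g, φ, t⟩, hφ⟩ ⟨ψ, b, hψ, h, hb⟩
      obtain rfl : φ = 0 := hφ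
      have h1 := hA ψ b hψ (-f) (-g) fun z => by
        have := h z
        change 0 ≤ f.1 z.fst + g.1 z.snd + 0 + ψ.1 z at this
        change -f.1 z.fst + -g.1 z.snd ≤ ψ.1 z
        linarith
      have h2 := p.integralLM.map_neg f
      have h3 := q.integralLM.map_neg g
      change p.integralLM (-f) + q.integralLM (-g) ≤ b at h1
      change 0 ≤ p.integralLM f + q.integralLM g + t
      change b ≤ t at hb
      linarith) (by
      -- every function in the big space is dominated by some `f ⊕ g`
      rintro ⟨f, g, φ, t⟩
      obtain ⟨K, a, b, ha, hb, hab⟩ := exists_lipschitz_add_bound φ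
      refine ⟨⟨(⟨_, mem_lipDominated_of_lipschitzWith ha⟩ - f,
        ⟨_, mem_lipDominated_of_lipschitzWith hb⟩ - g, 0, -t), rfl⟩,
        0, 0, A.zero_mem, fun z => ?_, ?_⟩
      · change 0 ≤ (a z.fst - f.1 z.fst + f.1 z.fst) + (b z.snd - g.1 z.snd + g.1 z.snd)
          + (0 + φ.1 z) + 0
        linarith [(abs_le.1 (hab z)).1]
      · change 0 ≤ -t + t
        linarith)
  let Λ : lipDominated (MetTensor X Y) →ₗ[ℝ] ℝ :=
    G ∘ₗ LinearMap.inr ℝ _ _ ∘ₗ LinearMap.inr ℝ _ _ ∘ₗ LinearMap.inl ℝ _ _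
  have hGval : ∀ f g t φ, G (f, g, φ, t) = p.integralLM f + q.integralLM g + t + Λ φ := by
    intro f g t φ
    have h1 : G (f, g, 0, t) = p.integralLM f + q.integralLM g + t := hGF ⟨(f, g, 0, t), rfl⟩
    rw [← h1]
    change _ = G (f, g, 0, t) + G (0, 0, φ, 0)
    rw [← map_add]
    simp
  have hpos : ∀ f g t φ, (∃ ψ b, (ψ, b) ∈ A ∧
      (∀ z : MetTensor X Y, 0 ≤ f.1 z.fst + g.1 z.snd + φ.1 z + ψ.1 z) ∧ b ≤ t) →
      0 ≤ p.integralLM f + q.integralLM g + t + Λ φ := fun f g t φ h => by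
    rw [← hGval]
    exact hG _ h
  have hΛ : IsCouplingFunctional p q Λ := by
    refine ⟨fun φ hφ => ?_, fun f => ?_, fun g => ?_⟩
    · simpa using hpos 0 0 0 φ ⟨0, 0, A.zero_mem, fun z => by simpa using hφ z, le_rfl⟩
    · have h1 := hpos f 0 0 (-pullback MetTensor.fst MetTensor.lipschitzWith_fst f)
        ⟨0, 0, A.zero_mem, fun z => by simp [pullback], le_rfl⟩
      have h2 := hpos (-f) 0 0 (pullback MetTensor.fst MetTensor.lipschitzWith_fst f)
        ⟨0, 0, A.zero_mem, fun z => by simp [pullback], le_rfl⟩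
      simp only [map_neg, map_zero] at h1 h2
      change _ = p.integralLM f
      linarith
    · have h1 := hpos 0 g 0 (-pullback MetTensor.snd MetTensor.lipschitzWith_snd g)
        ⟨0, 0, A.zero_mem, fun z => by simp [pullback], le_rfl⟩
      have h2 := hpos 0 (-g) 0 (pullback MetTensor.snd MetTensor.lipschitzWith_snd g)
        ⟨0, 0, A.zero_mem, fun z => by simp [pullback], le_rfl⟩
      simp only [map_neg, map_zero] at h1 h2
      change _ = q.integralLM g
      linarith
  obtain ⟨r, hr, hrΛ⟩ := hΛ.exists_coupling
  refine ⟨r, hr, fun ψ b hψ => ?_⟩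
  rw [hrΛ]
  have := hpos 0 0 b (-ψ) ⟨ψ, b, hψ, fun z => by simp, le_rfl⟩
  simp only [map_neg, map_zero] at this
  linarith

end Extension

/-! ### The transform with respect to a cost -/

section Transform

/-- The `c`-transform of `g`: if `f ⊕ g ≤ h`, then the largest `f'` with `f' ⊕ g ≤ h` inherits
every modulus of continuity of `h` in the first variable. -/
theorem exists_cTransform {X Y : Type*} [Nonempty Y] {h : X → Y → ℝ} {e : X → X → ℝ}
    (hh : ∀ x x' y, h x y - h x' y ≤ e x x') {f : X → ℝ} {g : Y → ℝ}
    (hfg : ∀ x y, f x + g y ≤ h x y) :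
    ∃ f' : X → ℝ, (∀ x, f x ≤ f' x) ∧ (∀ x y, f' x + g y ≤ h x y) ∧
      ∀ x x', f' x - f' x' ≤ e x x' := by
  have hbdd : ∀ x, BddBelow (range fun y => h x y - g y) := fun x => by
    refine ⟨f x, ?_⟩
    rintro _ ⟨y, rfl⟩
    linarith [hfg x y]
  refine ⟨fun x => ⨅ y, (h x y - g y), fun x => le_ciInf fun y => by linarith [hfg x y],
    fun x y => by linarith [ciInf_le (hbdd x) y], fun x x' => ?_⟩
  have : (⨅ y, (h x y - g y)) - e x x' ≤ ⨅ y, (h x' y - g y) :=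
    le_ciInf fun y => by linarith [ciInf_le (hbdd x) y, hh x x' y]
  linarith

theorem lipschitzWith_of_le_of_triangle {X : Type*} [MetricSpace X] {c : X → X → ℝ}
    (hc : ∀ x y, c x y ≤ dist x y)
    (htri : ∀ x y z, c x z ≤ c x y + c y z) :
    LipschitzWith 1 fun z : MetTensor X X => c z.fst z.snd :=
  LipschitzWith.of_le_add fun z w => by
    have h1 := htri z.fst w.fst z.snd
    have h2 := htri w.fst w.snd z.snd
    have h3 := hc z.fst w.fst
    have h4 := hc w.snd z.snd
    rw [MetTensor.dist_eq, dist_comm z.snd]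
    linarith

/-- The multiples of a single constraint `∫ ψ dr ≤ m`. -/
def rayCone {E : Type*} [AddCommGroup E] [Module ℝ E] (ψ : E) (m : ℝ) :
    PointedCone ℝ (E × ℝ) where
  carrier := {w | ∃ k : ℝ, 0 ≤ k ∧ w = (k • ψ, k * m)}
  add_mem' := by
    rintro _ _ ⟨k, hk, rfl⟩ ⟨k', hk', rfl⟩
    exact ⟨k + k', add_nonneg hk hk', by rw [Prod.mk_add_mk, add_smul, add_mul]⟩
  zero_mem' := ⟨0, le_rfl, by rw [zero_smul, zero_mul]; rfl⟩
  smul_mem' := by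
    rintro c _ ⟨k, hk, rfl⟩
    refine ⟨c.1 * k, mul_nonneg c.2 hk, ?_⟩
    change (c.1 • k • ψ, c.1 * (k * m)) = _
    rw [smul_smul, mul_assoc]

end Transform

variable {X Y : Type*} [MetricSpace X] [MeasurableSpace X] [BorelSpace X]
  [MetricSpace Y] [MeasurableSpace Y] [BorelSpace Y]

/-! ### Metric lifting -/

section Lifting

theorem lipschitzWith_marginals :
    LipschitzWith 1 (marginals : KSpace (MetTensor X Y) → MetTensor (KSpace X) (KSpace Y)) := by
  refine LipschitzWith.of_dist_le_mul fun r r' => ?_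
  rw [NNReal.coe_one, one_mul, MetTensor.dist_eq, ← le_sub_iff_add_le]
  refine ciSup_le fun f => ?_
  rw [le_sub_comm]
  refine ciSup_le fun g => ?_
  rw [le_sub_iff_add_le]
  have hf : LipschitzWith 1 fun z : MetTensor X Y => f.1 z.fst :=
    (f.2.comp MetTensor.lipschitzWith_fst).weaken (by simp)
  have hg : LipschitzWith 1 fun z : MetTensor X Y => g.1 z.snd :=
    (g.2.comp MetTensor.lipschitzWith_snd).weaken (by simp)
  have hfg : LipschitzWith 1 fun z : MetTensor X Y => f.1 z.fst + g.1 z.snd :=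
    LipschitzWith.of_le_add fun z w => by
      have h1 := f.2.le_add_mul z.fst w.fst
      have h2 := g.2.le_add_mul z.snd w.snd
      rw [NNReal.coe_one, one_mul] at h1 h2
      rw [MetTensor.dist_eq]
      linarith
  have h := sub_le_dist r r' hfg
  rw [integral_add (r.integrable_of_short _ hf) (r.integrable_of_short _ hg),
    integral_add (r'.integrable_of_short _ hf) (r'.integrable_of_short _ hg),
    integral_fst rfl f.2.continuous, integral_fst rfl f.2.continuous,
    integral_snd rfl g.2.continuous, integral_snd rfl g.2.continuous] at h
  change (∫ y, g.1 y ∂(r'.toMeasure.map MetTensor.snd)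
      - ∫ y, g.1 y ∂(r.toMeasure.map MetTensor.snd))
    + (∫ x, f.1 x ∂(r'.toMeasure.map MetTensor.fst)
      - ∫ x, f.1 x ∂(r.toMeasure.map MetTensor.fst))
    ≤ dist r r'
  linarith

/-- The constraints `∫ ψ dr' ≤ ∫ ψ dr + L D` for `L`-Lipschitz functions `ψ`, which together say
that `d(r, r') ≤ D`. -/
def distCone {Z : Type*} [MetricSpace Z] [MeasurableSpace Z] [BorelSpace Z] (r : KSpace Z)
    (D : ℝ) : PointedCone ℝ (lipDominated Z × ℝ) where
  carrier := {w | ∃ L : ℝ, 0 ≤ L ∧ (∀ z z', w.1.1 z - w.1.1 z' ≤ L * dist z z') ∧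
    r.integralLM w.1 + L * D ≤ w.2}
  add_mem' := by
    rintro w w' ⟨L, hL, h, hb⟩ ⟨L', hL', h', hb'⟩
    refine ⟨L + L', add_nonneg hL hL', fun z z' => ?_, ?_⟩
    · change (w.1.1 z + w'.1.1 z) - (w.1.1 z' + w'.1.1 z') ≤ _
      linarith [h z z', h' z z']
    · rw [Prod.fst_add, map_add, Prod.snd_add]
      linarith
  zero_mem' := ⟨0, le_rfl, fun z z' => by simp, by simp⟩
  smul_mem' := by
    rintro c w ⟨L, hL, h, hb⟩
    refine ⟨c.1 * L, mul_nonneg c.2 hL, fun z z' => ?_, ?_⟩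
    · change c.1 * w.1.1 z - c.1 * w.1.1 z' ≤ _
      have := mul_le_mul_of_nonneg_left (h z z') c.2
      linarith
    · change r.integralLM (c.1 • w.1) + _ ≤ c.1 * w.2
      rw [map_smul, smul_eq_mul]
      have := mul_le_mul_of_nonneg_left hb c.2
      linarith

/-- Moving the marginals of `r` to prescribed ones costs no more than moving the marginals
themselves. -/
theorem exists_lift (r : KSpace (MetTensor X Y)) (k : MetTensor (KSpace X) (KSpace Y)) :
    ∃ r' : KSpace (MetTensor X Y), marginals r' = k ∧ dist r r' ≤ dist (marginals r) k := by
  set p := (marginals r).fst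
  set q := (marginals r).snd
  have hr : r.toMeasure ∈ couplings p q := marginals_eq_iff.1 rfl
  have := nonempty_of_isProbabilityMeasure p.toMeasure
  have := nonempty_of_isProbabilityMeasure q.toMeasure
  obtain ⟨r', hr', hA⟩ := exists_coupling_of_cone k.fst k.snd
    (distCone r (dist (marginals r) k)) (by
      rintro ψ b ⟨L, hL, hψ, hb⟩ f g hfg
      -- pass to the double `c`-transform, which is Lipschitz with the constant of `ψ`
      obtain ⟨f', hf', hf'g, hf'L⟩ := exists_cTransform
        (h := fun x y => ψ.1 (MetTensor.mk x y)) (e := fun x x' => L * dist x x')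
        (fun x x' y => (hψ _ _).trans_eq (by simp [MetTensor.dist_eq]))
        (fun x y => hfg (MetTensor.mk x y))
      obtain ⟨g', hg', hf'g', hg'L⟩ := exists_cTransform
        (h := fun y x => ψ.1 (MetTensor.mk x y)) (e := fun y y' => L * dist y y')
        (fun y y' x => (hψ _ _).trans_eq (by simp [MetTensor.dist_eq]))
        (fun y x => (add_comm _ _).trans_le (hf'g x y))
      have hf'm : f' ∈ lipDominated X := mem_lipDominated_of_sub_le hL hf'L
      have hg'm : g' ∈ lipDominated Y := mem_lipDominated_of_sub_le hL hg'L
      have h1 : ∫ x, f.1 x ∂k.fst.toMeasure ≤ ∫ x, f' x ∂k.fst.toMeasure :=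
        integral_mono (k.fst.integrable_of_mem_lipDominated f.2)
          (k.fst.integrable_of_mem_lipDominated hf'm) hf'
      have h2 : ∫ x, g.1 x ∂k.snd.toMeasure ≤ ∫ x, g' x ∂k.snd.toMeasure :=
        integral_mono (k.snd.integrable_of_mem_lipDominated g.2)
          (k.snd.integrable_of_mem_lipDominated hg'm) hg'
      have h3 := p.integral_sub_le_mul_dist k.fst hL hf'L
      have h4 := q.integral_sub_le_mul_dist k.snd hL hg'L
      have h5 := (isCouplingFunctional_integralLM hr).add_le_of_add_le (φ := ψ)
        ⟨f', hf'm⟩ ⟨g', hg'm⟩ fun z => (add_comm _ _).trans_le (hf'g' z.snd z.fst)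
      rw [MetTensor.dist_eq, mul_add] at hb
      simp only at h5 hb
      linarith)
  refine ⟨r', marginals_eq_iff.2 hr', ciSup_le fun φ => ?_⟩
  have h := hA ⟨φ.1, mem_lipDominated_of_lipschitzWith φ.2⟩
    (∫ z, φ.1 z ∂r.toMeasure + 1 * dist (marginals r) k)
    ⟨1, zero_le_one, fun z z' => by
      have := φ.2.le_add_mul z z'
      rw [NNReal.coe_one] at this
      simp only
      linarith, le_rfl⟩
  simp only at h
  linarith

end Lifting

/-! ### Compactness of the set of couplings -/

section Compactness

/-- The set of couplings is compact: the limit of an ultrafilter exists as a positive functional.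
Convergence in the Kantorovich-Wasserstein distance holds since almost optimal short functions
converge along the ultrafilter, uniformly so on finite sets, and finite sets come close to almost
all the mass, uniformly over all couplings. -/
theorem isCompact_couplings (p : KSpace X) (q : KSpace Y) :
    IsCompact {r : KSpace (MetTensor X Y) | r.toMeasure ∈ couplings p q} := by
  have hX := nonempty_of_isProbabilityMeasure p.toMeasure
  have hY := nonempty_of_isProbabilityMeasure q.toMeasure
  refine isCompact_iff_ultrafilter_le_nhds'.2 fun U hU => ?_
  have hcf : ∀ᶠ r in (U : Filter (KSpace (MetTensor X Y))), IsCouplingFunctional p q r.integralLM :=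
    mem_of_superset hU fun r hr => isCouplingFunctional_integralLM hr
  have hlim : ∀ φ : lipDominated (MetTensor X Y), ∃ t : ℝ,
      Tendsto (fun r : KSpace (MetTensor X Y) => r.integralLM φ) U (𝓝 t) := by
    intro φ
    obtain ⟨K, a, b, ha, hb, hab⟩ := exists_lipschitz_add_bound φ
    obtain ⟨t, -, ht⟩ := (isCompact_Icc
      (a := -(∫ x, a x ∂p.toMeasure + ∫ y, b y ∂q.toMeasure))
      (b := ∫ x, a x ∂p.toMeasure + ∫ y, b y ∂q.toMeasure)).ultrafilter_le_nhds'
      (U.map fun r => r.integralLM φ) (by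
        rw [Ultrafilter.mem_map]
        filter_upwards [hcf] with r hr
        exact abs_le.1 (hr.abs_le_of_abs_le_add ⟨a, mem_lipDominated_of_lipschitzWith ha⟩
          ⟨b, mem_lipDominated_of_lipschitzWith hb⟩ hab))
    exact ⟨t, ht⟩
  choose Λ₀ hΛ₀ using hlim
  let Λ : lipDominated (MetTensor X Y) →ₗ[ℝ] ℝ :=
    { toFun := Λ₀
      map_add' := fun φ ψ => tendsto_nhds_unique (hΛ₀ (φ + ψ)) (by
        simpa only [map_add] using (hΛ₀ φ).add (hΛ₀ ψ))
      map_smul' := fun c φ => tendsto_nhds_unique (hΛ₀ (c • φ)) (by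
        simpa only [map_smul, RingHom.id_apply] using (hΛ₀ φ).const_smul c) }
  have hΛ : IsCouplingFunctional p q Λ := by
    refine ⟨fun φ hφ => ?_, fun f => ?_, fun g => ?_⟩
    · exact ge_of_tendsto (hΛ₀ φ) (hcf.mono fun r hr => hr.nonneg φ hφ)
    · exact tendsto_nhds_unique (hΛ₀ _) (tendsto_const_nhds.congr'
        (hcf.mono fun r hr => (hr.fst f).symm))
    · exact tendsto_nhds_unique (hΛ₀ _) (tendsto_const_nhds.congr'
        (hcf.mono fun r hr => (hr.snd g).symm))
  obtain ⟨r₀, hr₀, hr₀Λ⟩ := hΛ.exists_coupling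
  have hr₀c := isCouplingFunctional_integralLM hr₀
  refine ⟨r₀, hr₀, ?_⟩
  change Tendsto id (U : Filter (KSpace (MetTensor X Y))) (𝓝 r₀)
  rw [Metric.tendsto_nhds]
  intro ε hε
  -- the proof bounds `dist r r₀` by `12 * δ`
  obtain ⟨δ, hδ0, hδ⟩ : ∃ δ : ℝ, 0 < δ ∧ ε = 13 * δ := ⟨ε / 13, by positivity, by ring⟩
  obtain ⟨x₀⟩ := hX
  obtain ⟨y₀⟩ := hY
  -- almost optimal short functions, normalised to vanish at a base point
  have hopt : ∀ r : KSpace (MetTensor X Y), ∃ φ : MetTensor X Y → ℝ, LipschitzWith 1 φ ∧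
      φ (MetTensor.mk x₀ y₀) = 0 ∧
      dist r r₀ - δ < ∫ z, φ z ∂r₀.toMeasure - ∫ z, φ z ∂r.toMeasure := by
    intro r
    obtain ⟨φ, hφ⟩ := exists_lt_of_lt_ciSup (sub_lt_self (dist r r₀) hδ0)
    have hsub : ∀ s : KSpace (MetTensor X Y), ∫ z, (φ.1 z - φ.1 (MetTensor.mk x₀ y₀)) ∂s.toMeasure
        = ∫ z, φ.1 z ∂s.toMeasure - φ.1 (MetTensor.mk x₀ y₀) := fun s => by
      rw [integral_sub (s.integrable_of_short _ φ.2) (integrable_const _), integral_const,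
        probReal_univ, one_smul]
    refine ⟨fun z => φ.1 z - φ.1 (MetTensor.mk x₀ y₀), ?_, sub_self _, ?_⟩
    · exact LipschitzWith.of_dist_le_mul fun z w => by
        rw [dist_sub_right]
        exact φ.2.dist_le_mul z w
    · rw [hsub, hsub]
      linarith
  choose φ hφL hφ0 hφd using hopt
  have hφlim : ∀ z, ∃ t : ℝ, Tendsto (fun r => φ r z) U (𝓝 t) := by
    intro z
    obtain ⟨t, -, ht⟩ := (isCompact_Icc (a := -dist z (MetTensor.mk x₀ y₀))
      (b := dist z (MetTensor.mk x₀ y₀))).ultrafilter_le_nhds' (U.map fun r => φ r z) (by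
        rw [Ultrafilter.mem_map]
        refine Eventually.of_forall fun r => abs_le.1 ?_
        have := (hφL r).dist_le_mul z (MetTensor.mk x₀ y₀)
        rwa [Real.dist_eq, hφ0, sub_zero, NNReal.coe_one, one_mul] at this)
    exact ⟨t, ht⟩
  choose Φ hΦ using hφlim
  have hΦL : LipschitzWith 1 Φ := LipschitzWith.of_dist_le_mul fun z w =>
    le_of_tendsto ((hΦ z).dist (hΦ w)) (Eventually.of_forall fun r => (hφL r).dist_le_mul z w)
  obtain ⟨M, hM, hMp⟩ := p.exists_finset_integral_infDist_le hδ0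
  obtain ⟨N, hN, hNq⟩ := q.exists_finset_integral_infDist_le hδ0
  have hnet : ∀ᶠ r in (U : Filter (KSpace (MetTensor X Y))), ∀ w ∈ M ×ˢ N,
      |φ r (MetTensor.mk w.1 w.2) - Φ (MetTensor.mk w.1 w.2)| < δ :=
    (Filter.eventually_all_finset _).2 fun w _ => Metric.tendsto_nhds.1 (hΦ _) δ hδ0
  have hΦm := mem_lipDominated_of_lipschitzWith hΦL
  have hint := Metric.tendsto_nhds.1 (hΛ₀ ⟨Φ, hΦm⟩) δ hδ0
  filter_upwards [hnet, hint, hcf] with r hr1 hr2 hr3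
  have hφm := mem_lipDominated_of_lipschitzWith (hφL r)
  have hfm : (fun x => δ + 2 * Metric.infDist x M) ∈ lipDominated X :=
    mem_lipDominated_of_lipschitzWith (K := 2) (LipschitzWith.of_le_add_mul 2 fun x y => by
      have := Metric.infDist_le_infDist_add_dist (s := (M : Set X)) (x := x) (y := y)
      simp only [NNReal.coe_ofNat]
      linarith)
  have hgm : (fun y => 2 * Metric.infDist y N) ∈ lipDominated Y :=
    mem_lipDominated_of_lipschitzWith (K := 2) (LipschitzWith.of_le_add_mul 2 fun x y => by
      have := Metric.infDist_le_infDist_add_dist (s := (N : Set Y)) (x := x) (y := y)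
      simp only [NNReal.coe_ofNat]
      linarith)
  have hbound : ∀ z : MetTensor X Y, |φ r z - Φ z|
      ≤ (δ + 2 * Metric.infDist z.fst M) + 2 * Metric.infDist z.snd N := by
    intro z
    obtain ⟨x, hx, hzx⟩ := M.finite_toSet.isCompact.exists_infDist_eq_dist hM z.fst
    obtain ⟨y, hy, hzy⟩ := N.finite_toSet.isCompact.exists_infDist_eq_dist hN z.snd
    have h1 := abs_lt.1 (hr1 (x, y) (Finset.mem_product.2 ⟨hx, hy⟩))
    have h2 := (hφL r).dist_le_mul z (MetTensor.mk x y)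
    have h3 := hΦL.dist_le_mul z (MetTensor.mk x y)
    rw [MetTensor.dist_eq, NNReal.coe_one, one_mul, Real.dist_eq, MetTensor.fst_mk,
      MetTensor.snd_mk, ← hzx, ← hzy] at h2 h3
    have h4 := abs_le.1 h2
    have h5 := abs_le.1 h3
    simp only at h1
    rw [abs_le]
    constructor <;> linarith
  have hmass : ∫ x, (δ + 2 * Metric.infDist x M) ∂p.toMeasure
      + ∫ y, 2 * Metric.infDist y N ∂q.toMeasure ≤ 5 * δ := by
    rw [integral_add (integrable_const _)
      ((p.integrable_of_lipschitzWith (Metric.lipschitz_infDist_pt _)).const_mul 2),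
      integral_const, integral_const_mul, integral_const_mul, probReal_univ, one_smul]
    linarith
  have hclose : ∀ s : KSpace (MetTensor X Y), IsCouplingFunctional p q s.integralLM →
      |∫ z, φ r z ∂s.toMeasure - ∫ z, Φ z ∂s.toMeasure| ≤ 5 * δ := fun s hs => by
    have h := hs.abs_le_of_abs_le_add (φ := ⟨_, hφm⟩ - ⟨_, hΦm⟩) ⟨_, hfm⟩ ⟨_, hgm⟩ hbound
    rw [map_sub] at h
    exact h.trans hmass
  have h1 := abs_le.1 (hclose r hr3)
  have h2 := abs_le.1 (hclose r₀ hr₀c)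
  have h3 : |∫ z, Φ z ∂r.toMeasure - ∫ z, Φ z ∂r₀.toMeasure| < δ := by
    rw [hr₀Λ ⟨Φ, hΦm⟩]
    exact hr2
  have h4 := abs_lt.1 h3
  have h5 := hφd r
  change dist r r₀ < ε
  linarith

/-- Properness reduces to compactness of a single fibre, since points can be moved into it along
lifts. -/
theorem isCompact_preimage_marginals {K : Set (MetTensor (KSpace X) (KSpace Y))}
    (hK : IsCompact K) :
    IsCompact ((marginals : KSpace (MetTensor X Y) → _) ⁻¹' K) := by
  refine isCompact_iff_ultrafilter_le_nhds'.2 fun U hU => ?_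
  obtain ⟨k, hkK, hk⟩ := hK.ultrafilter_le_nhds' (U.map marginals) hU
  choose T hT hTd using fun r : KSpace (MetTensor X Y) => exists_lift r k
  obtain ⟨r₀, hr₀, hr₀T⟩ := (isCompact_couplings k.fst k.snd).ultrafilter_le_nhds' (U.map T)
    (by
      rw [Ultrafilter.mem_map]
      exact Eventually.of_forall fun r => marginals_eq_iff.1 (hT r))
  refine ⟨r₀, ?_, ?_⟩
  · rw [mem_preimage, marginals_eq_iff.2 hr₀]
    exact hkK
  · change Tendsto id (U : Filter (KSpace (MetTensor X Y))) (𝓝 r₀)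
    have hk' : Tendsto marginals (U : Filter (KSpace (MetTensor X Y))) (𝓝 k) := hk
    have hT' : Tendsto T (U : Filter (KSpace (MetTensor X Y))) (𝓝 r₀) := hr₀T
    rw [tendsto_iff_dist_tendsto_zero] at hk' hT' ⊢
    refine squeeze_zero (fun _ => dist_nonneg) (fun r => ?_)
      (by simpa using hk'.add hT')
    exact (dist_triangle r (T r) r₀).trans (add_le_add_left (hTd r) _)

theorem couplings_eq_image (p : KSpace X) (q : KSpace Y) :
    couplings p q = toMeasure '' (marginals ⁻¹' {MetTensor.mk p q}) := by
  ext r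
  constructor
  · intro hr
    exact ⟨ofCoupling hr, marginals_eq_iff.2 hr, rfl⟩
  · rintro ⟨r, hr, rfl⟩
    exact marginals_eq_iff.1 hr

end Compactness

/-! ### Kantorovich duality -/

section Duality

/-- **Kantorovich duality** for costs that satisfy the triangle inequality and are bounded by the
metric. -/
theorem kantorovich_duality (p q : KSpace X) {c : X → X → ℝ} (hc0 : ∀ x y, 0 ≤ c x y)
    (hc : ∀ x y, c x y ≤ dist x y) (htri : ∀ x y z, c x z ≤ c x y + c y z) :
    ∃ m : ℝ, IsLeast ((fun r : Measure (MetTensor X X) => ∫ z, c z.fst z.snd ∂r) ''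
        couplings p q) m ∧
      IsLUB {t : ℝ | ∃ f : X → ℝ, (∀ x y, f y - f x ≤ c x y) ∧
        t = ∫ x, f x ∂q.toMeasure - ∫ x, f x ∂p.toMeasure} m := by
  have hX := nonempty_of_isProbabilityMeasure p.toMeasure
  set S := {t : ℝ | ∃ f : X → ℝ, (∀ x y, f y - f x ≤ c x y) ∧
    t = ∫ x, f x ∂q.toMeasure - ∫ x, f x ∂p.toMeasure}
  have hfL : ∀ f : X → ℝ, (∀ x y, f y - f x ≤ c x y) → LipschitzWith 1 f := fun f hf =>
    LipschitzWith.of_le_add fun x y => by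
      have h1 := hf y x
      have h2 := hc y x
      rw [dist_comm]
      linarith
  have hcm : (fun z : MetTensor X X => c z.fst z.snd) ∈ lipDominated (MetTensor X X) :=
    mem_lipDominated_of_lipschitzWith (lipschitzWith_of_le_of_triangle hc htri)
  have hSlub : IsLUB S (sSup S) := by
    refine isLUB_csSup ⟨0, fun _ => 0, by simpa using hc0, by simp⟩ ⟨dist p q, ?_⟩
    rintro _ ⟨f, hf, rfl⟩
    exact sub_le_dist p q (hfL f hf)
  -- weak duality
  have hweak : ∀ r ∈ couplings p q, sSup S ≤ ∫ z, c z.fst z.snd ∂r := by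
    intro r hr
    refine hSlub.2 ?_
    rintro _ ⟨f, hf, rfl⟩
    have h := (isCouplingFunctional_integralLM (r := ofCoupling hr) hr).add_le_of_add_le
      (φ := ⟨_, hcm⟩) ⟨_, mem_lipDominated_of_lipschitzWith (hfL f hf).neg⟩
      ⟨_, mem_lipDominated_of_lipschitzWith (hfL f hf)⟩ fun z => by
        have := hf z.fst z.snd
        simp only [Pi.neg_apply]
        linarith
    simp only [Pi.neg_apply, integral_neg] at h
    change _ ≤ ∫ z, c z.fst z.snd ∂r at h
    linarith
  obtain ⟨r, hr, hrc⟩ := exists_coupling_of_cone p q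
    (rayCone ⟨fun z => c z.fst z.snd, hcm⟩ (sSup S)) (by
      rintro ψ b ⟨k, hk, hw⟩ f g hfg
      obtain ⟨rfl, rfl⟩ := Prod.mk.inj hw
      have hfg' : ∀ x y, f.1 x + g.1 y ≤ k * c x y := fun x y => hfg (MetTensor.mk x y)
      obtain ⟨h, hgh, hfh, hhc⟩ := exists_cTransform (h := fun y x => k * c x y)
        (e := fun y y' => k * c y' y)
        (fun y y' x => by nlinarith [htri x y' y])
        (fun y x => (add_comm _ _).trans_le (hfg' x y))
      -- `c` vanishes on the diagonal, so the other half of the pair is dominated by `-h`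
      have hf : ∀ x, f.1 x ≤ -h x := fun x => by
        have h1 := hfh x x
        have h2 : c x x = 0 := le_antisymm ((hc x x).trans_eq (dist_self x)) (hc0 x x)
        simp only [h2, mul_zero] at h1
        linarith
      have hhm : h ∈ lipDominated X := mem_lipDominated_of_sub_le hk fun x y => by
        rw [dist_comm]
        exact (hhc x y).trans (mul_le_mul_of_nonneg_left (hc y x) hk)
      have h1 : ∫ x, f.1 x ∂p.toMeasure ≤ ∫ x, -h x ∂p.toMeasure :=
        integral_mono (p.integrable_of_mem_lipDominated f.2)
          (p.integrable_of_mem_lipDominated hhm).neg hf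
      have h2 : ∫ x, g.1 x ∂q.toMeasure ≤ ∫ x, h x ∂q.toMeasure :=
        integral_mono (q.integrable_of_mem_lipDominated g.2)
          (q.integrable_of_mem_lipDominated hhm) hgh
      rw [integral_neg] at h1
      suffices hs : ∫ x, h x ∂q.toMeasure - ∫ x, h x ∂p.toMeasure ≤ k * sSup S by linarith
      rcases hk.eq_or_lt with rfl | hk
      · have hconst : ∀ x y, h x = h y := fun x y => by
          have h3 := hhc x y
          have h4 := hhc y x
          rw [zero_mul] at h3 h4
          linarith
        have x₀ := hX.some
        have : h = fun _ => h x₀ := funext fun x => hconst x x₀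
        rw [this]
        simp
      · have hmem := hSlub.1 ⟨fun x => k⁻¹ * h x, fun x y => by
          rw [← mul_sub, inv_mul_le_iff₀ hk]
          exact hhc y x, rfl⟩
        rwa [integral_const_mul, integral_const_mul, ← mul_sub, inv_mul_le_iff₀ hk] at hmem)
  have hmin := hrc ⟨fun z => c z.fst z.snd, hcm⟩ (sSup S) ⟨1, zero_le_one, by simp⟩
  refine ⟨sSup S, ⟨⟨r.toMeasure, hr, le_antisymm hmin (hweak _ hr)⟩, ?_⟩, hSlub⟩
  rintro _ ⟨r', hr', rfl⟩
  exact hweak r' hr'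

end Duality

end KSpace

theorem mainTheorem11 {X Y : Type*}
    [MetricSpace X] [CompleteSpace X] [MeasurableSpace X] [BorelSpace X]
    [MetricSpace Y] [CompleteSpace Y] [MeasurableSpace Y] [BorelSpace Y] :
    -- the marginal map is short and has the metric lifting property
    HasMetricLifting
      (KSpace.marginals : KSpace (MetTensor X Y) → MetTensor (KSpace X) (KSpace Y)) ∧
    -- the marginal map is proper
    (∀ K : Set (MetTensor (KSpace X) (KSpace Y)), IsCompact K →
      IsCompact ((KSpace.marginals : KSpace (MetTensor X Y) → _) ⁻¹' K)) ∧
    -- couplings form the fibres of the marginal map, which are compact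
    (∀ (p : KSpace X) (q : KSpace Y),
      KSpace.couplings p q = KSpace.toMeasure '' (KSpace.marginals ⁻¹' {MetTensor.mk p q}) ∧
      IsCompact {r : KSpace (MetTensor X Y) | r.toMeasure ∈ KSpace.couplings p q}) ∧
    -- the infimum in the Kantorovich duality formula is attained
    (∀ (p q : KSpace X) (c : X → X → ℝ),
      LowerSemicontinuous (fun z : MetTensor X X => c z.fst z.snd) →
      (∀ x y, 0 ≤ c x y) → (∀ x y, c x y ≤ dist x y) →
      (∀ x y z, c x z ≤ c x y + c y z) →
      (∀ r ∈ KSpace.couplings p q, Integrable (fun z => c z.fst z.snd) r) ∧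
      ∃ m : ℝ,
        IsLeast ((fun r : Measure (MetTensor X X) => ∫ z, c z.fst z.snd ∂r) ''
          KSpace.couplings p q) m ∧
        IsLUB {t : ℝ | ∃ f : X → ℝ, (∀ x y, f y - f x ≤ c x y) ∧
          t = ∫ x, f x ∂q.toMeasure - ∫ x, f x ∂p.toMeasure} m) := by
  refine ⟨⟨KSpace.lipschitzWith_marginals, fun C _ r k hrk => ?_⟩,
    fun K hK => KSpace.isCompact_preimage_marginals hK,
    fun p q => ⟨KSpace.couplings_eq_image p q, KSpace.isCompact_couplings p q⟩,
    fun p q c _ hc0 hc htri => ⟨fun r hr => ?_, KSpace.kantorovich_duality p q hc0 hc htri⟩⟩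
  · obtain ⟨r', hr', hd⟩ := KSpace.exists_lift r k
    exact ⟨r', hr', hd.trans_lt hrk⟩
  · exact KSpace.couplings_integrable_of_short hr _
      (KSpace.lipschitzWith_of_le_of_triangle hc htri)
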